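/- For a finite tree $T$ and a vertex $w$ of $T$, let $T(w)$ be the forest obtained from $T$ by deleting $w$, and for a neighbor $u$ of $w$ let $T_u(w)$ be the connected component of $T(w)$ containing $u$. A component is called odd if it has an odd number of vertices. The property that $T$ is NEB (has nearly even branching) at $w$ is defined recursively: a tree with one vertex is NEB at that vertex; a tree $T$ with $n\ge 2$ vertices is NEB at $w$ if (i) $T(w)$ has exactly one odd component when $n$ is even, and no odd component when $n$ is odd; and (ii) for every neighbor $u$ of $w$ in $T$, the tree $T_u(w)$ is NEB at $u$. Theorem. Let $n\ge 2$, and let $G$ be a connected graph on the vertices $1,2,\dots,n$. Let $$\lambda_1<\mu_1<\lambda_2<\cdots<\mu_{n-1}<\lambda_n$$ be $2n-1$ real numbers such that $\lambda_j=-\lambda_{n+1-j}$ for all $j=1,\dots,n$ and $\mu_k=-\mu_{n-k}$ for all $k=1,\dots,n-1$. If $G$ has a spanning tree $T$ that is NEB at a vertex $v$, then there is a real skew-symmetric $n\times n$ matrix $A=[a_{ij}]$ with graph $G$ (that is, for $i\ne j$, $a_{ij}\neq 0$ if and only if $\{i,j\}$ is an edge of $G$) such that the eigenvalues of $A$ are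 $\mathrm{i}\lambda_1,\dots,\mathrm{i}\lambda_n$ and the eigenvalues of $A(v)$, the matrix obtained from $A$ by deleting row and column $v$, are $\mathrm{i}\mu_1,\dots,\mathrm{i}\mu_{n-1}$. -/

import Mathlib

universe u

namespace SkewInverseEigenvalue

/-- `T(w)`: the graph obtained from `T` by deleting the vertex `w`. -/
abbrev deleteVertex {V : Type u} (T : SimpleGraph V) (w : V) : SimpleGraph {x : V // x ≠ w} :=
  T.comap Subtype.val

/-- The vertex set of `T_v(w)`: the connected component of `T(w)` that contains `v`. -/
abbrev branch {V : Type u} (T : SimpleGraph V) (w v : V) (hv : v ≠ w) :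
    (deleteVertex T w).ConnectedComponent :=
  (deleteVertex T w).connectedComponentMk ⟨v, hv⟩

/-- `T` has the nearly even branching property at `w` (`T` is NEB at `w`). The notion is meant
for a (finite) tree `T`; that `T` is a tree is assumed separately where the notion is used.
Here `(branch T w v _).toSimpleGraph` is the graph `T_v(w)`, and its root is the vertex `v`. -/
inductive IsNEB : ∀ {V : Type u}, SimpleGraph V → V → Prop
  | single {V : Type u} (T : SimpleGraph V) (w : V) (hcard : Nat.card V = 1) : IsNEB T w
  | step {V : Type u} (T : SimpleGraph V) (w : V) (hcard : 2 ≤ Nat.card V)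
      (heven : Even (Nat.card V) → (deleteVertex T w).oddComponents.ncard = 1)
      (hodd : Odd (Nat.card V) → (deleteVertex T w).oddComponents = ∅)
      (hbranch : ∀ (v : V) (h : T.Adj w v),
        IsNEB (branch T w v h.ne').toSimpleGraph ⟨⟨v, h.ne'⟩, rfl⟩) :
      IsNEB T w

/-- `S⁻(G)`: the real skew-symmetric matrices whose graph is `G`, that is, such that distinct
`i`, `j` are adjacent in `G` exactly when the `(i, j)` entry is nonzero. -/
def skewMatrices {V : Type u} (G : SimpleGraph V) : Set (Matrix V V ℝ) :=
  {A | A.transpose = -A ∧ ∀ i j : V, i ≠ j → (G.Adj i j ↔ A i j ≠ 0)}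

/-- `A(v)`: the principal submatrix obtained by deleting row and column `v`. -/
def deleteRowCol {V : Type u} (A : Matrix V V ℝ) (v : V) :
    Matrix {x : V // x ≠ v} {x : V // x ≠ v} ℝ :=
  A.submatrix Subtype.val Subtype.val

/-- `σ(A)`: the set of complex eigenvalues of the real square matrix `A`. -/
def eigenvalueSet {V : Type u} [Fintype V] [DecidableEq V] (A : Matrix V V ℝ) : Set ℂ :=
  spectrum ℂ (A.map (fun a : ℝ => (a : ℂ)))

end SkewInverseEigenvalue

/-! An explicit skew matrix `borderedMatrix` has the required spectra, with no regard to the graph.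
From then on only the orthonormal basis changes, while its vector `e` at `v` stays fixed; this
preserves the spectrum of the operator and that of its compression to `eᗮ`, hence both prescribed
spectra.

A basis with graph `T` comes from recursion on the tree. The compression to `eᗮ` is skew, and a skew
operator splits orthogonally into invariant subspaces of prescribed dimensions as long as at most
one of them is odd. NEB supplies exactly this: one subspace for each component of `T(w)`. In each
subspace the projection of `A e`, normalized, is placed at the neighbor of `w`; it is again cyclic,
so the recursion continues (`Realizable.of_components`).

To pass from `T` to `G`, the recursion also carries a rigidity: a skew `K` with `K e = 0` whose
commutator with `A` vanishes at the non-edges of `T` is zero. The reason is cyclicity: a block of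
`K` between two of the invariant subspaces commutes with the compression, hence is a polynomial in
it, hence cannot move one subspace into another. Such `K` form a space whose dimension is the number
of non-edges of `T`. So conjugation by `exp K` has a bijective derivative onto the entries at
non-edges, and these entries can take any small values, in particular nonzero ones exactly on the
edges of `G` (`IsRealization.exists_of_le`). -/

namespace SkewInverseEigenvalue

open Module Submodule

/-! ### Invariant subspaces of skew operators. -/

section Skew

variable {E : Type*} [NormedAddCommGroup E] [InnerProductSpace ℝ E]

/-- A linear operator on a real inner product space is skew if it is minus its own adjoint. -/
def IsSkew (A : E →ₗ[ℝ] E) : Prop :=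
  ∀ x y, inner ℝ (A x) y = -inner ℝ x (A y)

/-- For skew `A`, this says that `e` is a cyclic vector of `A`: no nonzero invariant subspace is
orthogonal to `e`. -/
def Generates (A : E →ₗ[ℝ] E) (e : E) : Prop :=
  ∀ W : Submodule ℝ E, (∀ x ∈ W, A x ∈ W) → (∀ x ∈ W, inner ℝ e x = 0) → W = ⊥

theorem IsSkew.inner_self {A : E →ₗ[ℝ] E} (hA : IsSkew A) (x : E) : inner ℝ x (A x) = 0 := by
  have h := hA x x
  rw [real_inner_comm] at h
  linarith

theorem IsSkew.orthogonal_invariant {A : E →ₗ[ℝ] E} (hA : IsSkew A) {W : Submodule ℝ E}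
    (hW : ∀ x ∈ W, A x ∈ W) : ∀ x ∈ Wᗮ, A x ∈ Wᗮ := by
  intro x hx
  rw [mem_orthogonal] at hx ⊢
  intro y hy
  have h := hA y x
  rw [hx _ (hW y hy)] at h
  linarith

variable [FiniteDimensional ℝ E]

/-- `A * A` is symmetric, so it has an eigenbasis. For an eigenvector `x` with `A x ≠ 0`, the
orthogonal vectors `x` and `A x` span an invariant plane. -/
theorem IsSkew.exists_invariant_two {A : E →ₗ[ℝ] E} (hA : IsSkew A) (h2 : 2 ≤ finrank ℝ E) :
    ∃ W : Submodule ℝ E, (∀ x ∈ W, A x ∈ W) ∧ finrank ℝ W = 2 := by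
  by_cases h0 : A = 0
  · obtain ⟨f, hf⟩ := exists_linearIndependent_of_le_finrank h2
    refine ⟨span ℝ (Set.range f), fun x _ => by simp [h0], ?_⟩
    rw [finrank_span_eq_card hf, Fintype.card_fin]
  have hS : (A * A).IsSymmetric := fun x y => by
    simp only [Module.End.mul_apply]
    rw [hA, hA, neg_neg]
  obtain ⟨i, hi⟩ : ∃ i, A (hS.eigenvectorBasis rfl i) ≠ 0 := by
    by_contra! h
    exact h0 ((hS.eigenvectorBasis rfl).toBasis.ext fun i => by simpa using h i)
  set x := hS.eigenvectorBasis rfl i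
  have hx : A (A x) = (hS.eigenvalues rfl i) • x := hS.apply_eigenvectorBasis rfl i
  have hli : LinearIndependent ℝ ![x, A x] := by
    refine linearIndependent_of_ne_zero_of_inner_eq_zero (𝕜 := ℝ) ?_ ?_
    · intro k
      fin_cases k
      · intro h
        apply hi
        change x = 0 at h
        rw [h, map_zero]
      · exact hi
    · intro k l hkl
      fin_cases k <;> fin_cases l
      · exact absurd rfl hkl
      · exact hA.inner_self x
      · exact (real_inner_comm _ _).trans (hA.inner_self x)
      · exact absurd rfl hkl
  refine ⟨span ℝ (Set.range ![x, A x]), ?_, by rw [finrank_span_eq_card hli, Fintype.card_fin]⟩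
  intro y hy
  rw [Matrix.range_cons, Matrix.range_cons, Matrix.range_empty, Set.union_empty,
    Set.singleton_union] at hy ⊢
  obtain ⟨a, b, rfl⟩ := mem_span_pair.1 hy
  refine mem_span_pair.2 ⟨b * hS.eigenvalues rfl i, a, ?_⟩
  rw [map_add, map_smul, map_smul, hx, smul_smul, add_comm]

theorem IsSkew.exists_invariant_two_le {A : E →ₗ[ℝ] E} (hA : IsSkew A) {W : Submodule ℝ E}
    (hW : ∀ x ∈ W, A x ∈ W) (h2 : 2 ≤ finrank ℝ W) :
    ∃ U ≤ W, (∀ x ∈ U, A x ∈ U) ∧ finrank ℝ U = 2 := by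
  have hR : IsSkew (A.restrict hW) := fun x y => hA x y
  obtain ⟨U, hU, hU2⟩ := hR.exists_invariant_two h2
  refine ⟨U.map W.subtype, map_subtype_le W U, ?_, ?_⟩
  · rintro _ ⟨x, hx, rfl⟩
    exact ⟨_, hU x hx, rfl⟩
  · rw [finrank_map_subtype_eq, hU2]

theorem IsSkew.exists_invariant_even {A : E →ₗ[ℝ] E} (hA : IsSkew A) {W : Submodule ℝ E}
    (hW : ∀ x ∈ W, A x ∈ W) (d : ℕ) (hd : 2 * d ≤ finrank ℝ W) :
    ∃ U ≤ W, (∀ x ∈ U, A x ∈ U) ∧ finrank ℝ U = 2 * d := by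
  induction d with
  | zero => exact ⟨⊥, bot_le, by simp, by simp⟩
  | succ d ih =>
    obtain ⟨U, hUW, hU, hUd⟩ := ih (by omega)
    have hdim := finrank_add_inf_finrank_orthogonal hUW
    have hinv : ∀ x ∈ Uᗮ ⊓ W, A x ∈ Uᗮ ⊓ W := fun x hx =>
      ⟨hA.orthogonal_invariant hU x hx.1, hW x hx.2⟩
    obtain ⟨U', hU'W, hU', hU'2⟩ := hA.exists_invariant_two_le hinv (by omega)
    refine ⟨U ⊔ U', sup_le hUW (hU'W.trans inf_le_right), ?_, ?_⟩
    · intro x hx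
      obtain ⟨y, hy, z, hz, rfl⟩ := mem_sup.1 hx
      rw [map_add]
      exact add_mem (mem_sup_left (hU y hy)) (mem_sup_right (hU' z hz))
    · have h := finrank_sup_add_finrank_inf_eq U U'
      have hbot : U ⊓ U' = ⊥ :=
        (U.orthogonal_disjoint.mono_right (hU'W.trans inf_le_left)).eq_bot
      rw [hbot, finrank_bot] at h
      omega

/-- A skew operator splits orthogonally into invariant subspaces of prescribed dimensions, as long
as at most one of the dimensions is odd. -/
theorem IsSkew.exists_invariant_family {A : E →ₗ[ℝ] E} (hA : IsSkew A) {C : Type*} (s : Finset C)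
    (m : C → ℕ) (hodd : ∀ c ∈ s, ∀ d ∈ s, Odd (m c) → Odd (m d) → c = d) (W : Submodule ℝ E)
    (hW : ∀ x ∈ W, A x ∈ W) (hdim : finrank ℝ W = ∑ c ∈ s, m c) :
    ∃ F : C → Submodule ℝ E, (∀ c ∈ s, F c ≤ W ∧ (∀ x ∈ F c, A x ∈ F c) ∧ finrank ℝ (F c) = m c) ∧
      ∀ c ∈ s, ∀ d ∈ s, c ≠ d → F c ⟂ F d := by
  classical
  induction s using Finset.induction_on generalizing W with
  | empty => exact ⟨fun _ => ⊥, by simp, by simp⟩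
  | insert c s hc ih =>
    rw [Finset.sum_insert hc] at hdim
    obtain ⟨U, hUW, hU, hUd⟩ : ∃ U ≤ W, (∀ x ∈ U, A x ∈ U) ∧ finrank ℝ U = m c := by
      rcases Nat.even_or_odd (m c) with h | h
      · obtain ⟨d, hd⟩ := h.two_dvd
        obtain ⟨U, h⟩ := hA.exists_invariant_even hW d (by omega)
        exact ⟨U, h.1, h.2.1, by rw [h.2.2, hd]⟩
      -- An odd-dimensional piece is not a sum of planes; the even-dimensional remainder is, and the
      -- piece is its complement in `W`.
      · have hev : Even (∑ c ∈ s, m c) := by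
          refine Finset.sum_induction _ Even (fun _ _ => Even.add) Even.zero fun d hd => ?_
          by_contra hd'
          rw [Nat.not_even_iff_odd] at hd'
          have := hodd c (by simp) d (by simp [hd]) h hd'
          exact hc (this ▸ hd)
        obtain ⟨d, hd⟩ := hev.two_dvd
        obtain ⟨U, hUW, hU, hUd⟩ := hA.exists_invariant_even hW d (by omega)
        refine ⟨Uᗮ ⊓ W, inf_le_right,
          fun x hx => ⟨hA.orthogonal_invariant hU x hx.1, hW x hx.2⟩, ?_⟩
        have := finrank_add_inf_finrank_orthogonal hUW
        omega
    have hdim' := finrank_add_inf_finrank_orthogonal hUW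
    obtain ⟨F, hF, hFo⟩ := ih (fun a ha b hb => hodd a (by simp [ha]) b (by simp [hb])) (Uᗮ ⊓ W)
      (fun x hx => ⟨hA.orthogonal_invariant hU x hx.1, hW x hx.2⟩) (by omega)
    have hne : ∀ d ∈ s, d ≠ c := fun d hd h => hc (h ▸ hd)
    have hUF : ∀ d ∈ s, U ⟂ F d := fun d hd =>
      (isOrtho_iff_le.2 ((hF d hd).1.trans inf_le_left)).symm
    refine ⟨Function.update F c U, ?_, ?_⟩
    · intro d hd
      rcases Finset.mem_insert.1 hd with rfl | hd
      · rw [Function.update_self]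
        exact ⟨hUW, hU, hUd⟩
      · rw [Function.update_of_ne (hne d hd)]
        exact ⟨(hF d hd).1.trans inf_le_right, (hF d hd).2⟩
    · intro d hd d' hd' hdd
      rcases Finset.mem_insert.1 hd with rfl | hd <;> rcases Finset.mem_insert.1 hd' with rfl | hd'
      · exact absurd rfl hdd
      · rw [Function.update_self, Function.update_of_ne (hne d' hd')]
        exact hUF d' hd'
      · rw [Function.update_self, Function.update_of_ne (hne d (by assumption))]
        exact (hUF d (by assumption)).symm
      · rw [Function.update_of_ne (hne d hd), Function.update_of_ne (hne d' hd')]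
        exact hFo d hd d' hd' hdd

end Skew

end SkewInverseEigenvalue

/-! ### Compressions and cyclic vectors. -/

namespace SkewInverseEigenvalue

open Module Submodule

section Compression

variable {E : Type*} [NormedAddCommGroup E] [InnerProductSpace ℝ E]

/-- The compression of `A` to the orthogonal complement of a unit vector `e`, extended by zero
to the whole space. -/
noncomputable def deflate (A : E →ₗ[ℝ] E) (e : E) : E →ₗ[ℝ] E :=
  A - (innerₛₗ ℝ e ∘ₗ A).smulRight e - (innerₛₗ ℝ e).smulRight (A e)

theorem deflate_apply (A : E →ₗ[ℝ] E) (e x : E) :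
    deflate A e x = A x - (inner ℝ e (A x)) • e - (inner ℝ e x) • A e := rfl

theorem deflate_apply_of_inner_eq_zero (A : E →ₗ[ℝ] E) {e x : E} (h : inner ℝ e x = 0) :
    A x = deflate A e x + (inner ℝ e (A x)) • e := by
  rw [deflate_apply, h, zero_smul, sub_zero, sub_add_cancel]

variable {A : E →ₗ[ℝ] E} {e : E}

theorem IsSkew.deflate (hA : IsSkew A) : IsSkew (deflate A e) := fun x y => by
  simp only [deflate_apply, inner_sub_left, inner_sub_right, inner_smul_left, inner_smul_right,
    RCLike.conj_to_real]
  have h1 := hA e x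
  have h2 := hA e y
  have h3 := hA x y
  have h4 := real_inner_comm e x
  have h5 := real_inner_comm x (A e)
  rw [← h4, ← h5, h3, ← neg_eq_iff_eq_neg.2 h1, ← neg_eq_iff_eq_neg.2 h2]
  ring

/-- The compression would in general contain a further term with coefficient `⟨e, A e⟩`, which is
zero for skew `A`. -/
theorem inner_deflate (hA : IsSkew A) (he : ‖e‖ = 1) (x : E) :
    inner ℝ e (deflate A e x) = 0 := by
  simp only [deflate_apply, inner_sub_right, inner_smul_right, real_inner_self_eq_norm_sq, he,
    hA.inner_self]
  ring

theorem aeval_mem_of_invariant {M : E →ₗ[ℝ] E} {U : Submodule ℝ E} (hU : ∀ x ∈ U, M x ∈ U)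
    (p : Polynomial ℝ) {x : E} (hx : x ∈ U) : Polynomial.aeval M p x ∈ U := by
  induction p using Polynomial.induction_on' with
  | add p q hp hq =>
    rw [map_add]
    exact add_mem hp hq
  | monomial k a =>
    rw [Polynomial.aeval_monomial, ← Algebra.smul_def, LinearMap.smul_apply]
    refine U.smul_mem _ ?_
    induction k with
    | zero => simpa
    | succ k ih =>
      rw [pow_succ', Module.End.mul_apply]
      exact hU _ ih

theorem Generates.smul (hg : Generates A e) {c : ℝ} (hc : c ≠ 0) : Generates A (c • e) := by
  intro W hW hWe
  refine hg W hW fun x hx => ?_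
  have := hWe x hx
  rw [inner_smul_left] at this
  simpa [hc] using this

theorem Generates.ne_zero [Nontrivial E] (hg : Generates A e) : e ≠ 0 := by
  rintro rfl
  exact top_ne_bot (hg ⊤ (by simp) (by simp))

variable [FiniteDimensional ℝ E]

/-- The compression of an operator to a subspace. -/
noncomputable def compress (U : Submodule ℝ E) (A : E →ₗ[ℝ] E) : U →ₗ[ℝ] U :=
  U.orthogonalProjectionOnto.toLinearMap ∘ₗ A ∘ₗ U.subtype

theorem inner_orthogonalProjectionOnto (U : Submodule ℝ E) (x : U) (y : E) :
    inner ℝ x (U.orthogonalProjectionOnto y) = inner ℝ (x : E) y := by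
  rw [coe_inner, ← starProjection_apply, ← inner_starProjection_left_eq_right,
    starProjection_eq_self_iff.2 x.2]

theorem inner_compress (U : Submodule ℝ E) (A : E →ₗ[ℝ] E) (x y : U) :
    inner ℝ x (compress U A y) = inner ℝ (x : E) (A y) :=
  inner_orthogonalProjectionOnto U x (A y)

theorem IsSkew.compress {A : E →ₗ[ℝ] E} (hA : IsSkew A) (U : Submodule ℝ E) :
    IsSkew (compress U A) := fun x y => by
  rw [real_inner_comm, inner_compress, inner_compress, real_inner_comm, hA]

/-- `A e` is cyclic for the compression on `eᗮ`. A vector of `eᗮ` orthogonal to all `p(M) (A e)` is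
orthogonal to `A e`, so `A` and `M` agree on it; such vectors form an `A`-invariant subspace
orthogonal to `e`, which is zero. -/
theorem Generates.exists_aeval (hA : IsSkew A) (he : ‖e‖ = 1) (hg : Generates A e) {y : E}
    (hy : inner ℝ e y = 0) : ∃ p : Polynomial ℝ, Polynomial.aeval (deflate A e) p (A e) = y := by
  set M := deflate A e
  let U : Submodule ℝ E :=
    LinearMap.range ((LinearMap.applyₗ (A e)) ∘ₗ (Polynomial.aeval (R := ℝ) M).toLinearMap)
  have hM : ∀ x ∈ U, M x ∈ U := by
    rintro _ ⟨p, rfl⟩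
    refine ⟨Polynomial.X * p, ?_⟩
    simp
  have hAe : A e ∈ U := ⟨1, by simp⟩
  have heU : ∀ x ∈ U, inner ℝ e x = 0 := by
    rintro _ ⟨p, rfl⟩
    change inner ℝ e (Polynomial.aeval M p (A e)) = 0
    induction p using Polynomial.induction_on' with
    | add p q hp hq => rw [map_add, LinearMap.add_apply, inner_add_right, hp, hq, add_zero]
    | monomial k a =>
      rw [Polynomial.aeval_monomial, ← Algebra.smul_def, LinearMap.smul_apply, inner_smul_right]
      cases k with
      | zero => simp [hA.inner_self]
      | succ k => rw [pow_succ', Module.End.mul_apply, inner_deflate hA he, mul_zero]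
  have hW : Uᗮ ⊓ (ℝ ∙ e)ᗮ = ⊥ := by
    refine hg _ ?_ fun x hx => mem_orthogonal_singleton_iff_inner_right.1 hx.2
    intro x hx
    have hex := mem_orthogonal_singleton_iff_inner_right.1 hx.2
    have h0 : inner ℝ e (A x) = 0 := by
      rw [← neg_eq_zero, ← hA, (mem_orthogonal U x).1 hx.1 _ hAe]
    rw [deflate_apply_of_inner_eq_zero A hex, h0, zero_smul, add_zero]
    exact ⟨hA.deflate.orthogonal_invariant hM x hx.1,
      mem_orthogonal_singleton_iff_inner_right.2 (inner_deflate hA he x)⟩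
  have hUF : U ≤ (ℝ ∙ e)ᗮ := fun x hx => mem_orthogonal_singleton_iff_inner_right.2 (heU x hx)
  have hdim := finrank_add_inf_finrank_orthogonal hUF
  rw [hW, finrank_bot, add_zero] at hdim
  have hUeq := Submodule.eq_of_le_of_finrank_eq hUF hdim
  have hyU : y ∈ U := hUeq ▸ mem_orthogonal_singleton_iff_inner_right.2 hy
  exact hyU

/-- An operator commuting with the compression is determined on `eᗮ` by its value at the cyclic
vector `A e`. It therefore acts there as a polynomial in the compression, and polynomials preserve
invariant subspaces. -/
theorem Generates.mem_of_commute (hA : IsSkew A) (he : ‖e‖ = 1) (hg : Generates A e)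
    {X : E →ₗ[ℝ] E} (hX : Commute X (deflate A e)) (hXe : inner ℝ e (X (A e)) = 0)
    {U : Submodule ℝ E} (hU : ∀ x ∈ U, deflate A e x ∈ U) (heU : ∀ x ∈ U, inner ℝ e x = 0) {x : E}
    (hx : x ∈ U) : X x ∈ U := by
  obtain ⟨p, hp⟩ := hg.exists_aeval hA he hXe
  obtain ⟨q, rfl⟩ := hg.exists_aeval hA he (heU x hx)
  have hXq (q : Polynomial ℝ) : Commute X (Polynomial.aeval (deflate A e) q) := by
    induction q using Polynomial.induction_on' with
    | add p q hp hq =>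
      rw [map_add]
      exact hp.add_right hq
    | monomial k a =>
      rw [Polynomial.aeval_monomial]
      exact (Algebra.commute_algebraMap_right a X).mul_right (hX.pow_right k)
  rw [← Module.End.mul_apply, (hXq q).eq, Module.End.mul_apply, ← hp, ← Module.End.mul_apply,
    ← map_mul, mul_comm, map_mul, Module.End.mul_apply]
  exact aeval_mem_of_invariant hU p hx

theorem starProjection_comm_of_invariant {M : E →ₗ[ℝ] E} (hM : IsSkew M) {U : Submodule ℝ E}
    (hU : ∀ x ∈ U, M x ∈ U) (x : E) : U.starProjection (M x) = M (U.starProjection x) := by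
  refine eq_starProjection_of_mem_orthogonal (hU _ (starProjection_apply_mem U x)) ?_
  rw [← map_sub]
  exact hM.orthogonal_invariant hU _ (sub_starProjection_mem_orthogonal x)

/-- A skew operator annihilating the cyclic vector `e` and commuting with the compression of `A`
between two orthogonal invariant subspaces has no block between them. -/
theorem Generates.inner_eq_zero_of_commutator (hA : IsSkew A) (he : ‖e‖ = 1) (hg : Generates A e)
    {K : E →ₗ[ℝ] E} {U U' : Submodule ℝ E}
    (hU : ∀ x ∈ U, deflate A e x ∈ U) (heU : ∀ x ∈ U, inner ℝ e x = 0)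
    (hU' : ∀ x ∈ U', deflate A e x ∈ U') (heU' : ∀ x ∈ U', inner ℝ e x = 0) (hUU : U ⟂ U')
    (hK : ∀ x ∈ U', ∀ y ∈ U, inner ℝ x (K (deflate A e y) - deflate A e (K y)) = 0)
    {x y : E} (hx : x ∈ U') (hy : y ∈ U) : inner ℝ x (K y) = 0 := by
  -- The block of `K` from `U` to `U'`. It commutes with the compression because both projections
  -- do; its values lie in `U'` by construction and, on `U`, in `U` by `mem_of_commute`.
  let X : E →ₗ[ℝ] E :=
    U'.starProjection.toLinearMap ∘ₗ K ∘ₗ U.starProjection.toLinearMap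
  have hXM : Commute X (deflate A e) := by
    refine LinearMap.ext fun z => ?_
    change U'.starProjection (K (U.starProjection (deflate A e z))) =
      deflate A e (U'.starProjection (K (U.starProjection z)))
    rw [starProjection_comm_of_invariant hA.deflate hU,
      ← starProjection_comm_of_invariant hA.deflate hU', ← sub_eq_zero, ← map_sub,
      starProjection_apply_eq_zero_iff, mem_orthogonal]
    exact fun x' hx' => hK x' hx' _ (starProjection_apply_mem U z)
  have hmem : X y ∈ U := hg.mem_of_commute hA he hXM (heU' _ (starProjection_apply_mem U' _)) hU
    heU hy
  have h0 : X y = 0 := by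
    have := hUU.disjoint.le_bot ⟨hmem, starProjection_apply_mem U' _⟩
    simpa using this
  have h1 : U'.starProjection (K y) = 0 := by
    rw [← h0]
    change _ = U'.starProjection (K (U.starProjection y))
    rw [starProjection_eq_self_iff.2 hy]
  rw [starProjection_apply_eq_zero_iff, mem_orthogonal] at h1
  exact h1 x hx

theorem apply_eq_compress_of_invariant (hA : IsSkew A) {U : Submodule ℝ E}
    (hU : ∀ x ∈ U, deflate A e x ∈ U) (heU : ∀ x ∈ U, inner ℝ e x = 0) (x : U)
    (hx : inner ℝ (A e) (x : E) = 0) : A x = compress U A x := by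
  have h : A x = deflate A e x := by
    have := deflate_apply_of_inner_eq_zero A (heU x x.2)
    rwa [← neg_neg (inner ℝ e (A x)), ← hA, hx, neg_zero, zero_smul, add_zero] at this
  change A x = U.starProjection (A x)
  rw [starProjection_eq_self_iff.2]
  exact h ▸ hU x x.2

/-- On vectors of `U` orthogonal to `A e` the compression to `U` is `A` itself, so an invariant
subspace orthogonal to the projected vector is `A`-invariant and orthogonal to `e`. -/
theorem Generates.compress (hA : IsSkew A) (hg : Generates A e) {U : Submodule ℝ E}
    (hU : ∀ x ∈ U, deflate A e x ∈ U) (heU : ∀ x ∈ U, inner ℝ e x = 0) :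
    Generates (compress U A) (U.orthogonalProjectionOnto (A e)) := by
  intro W hW hWe
  have h : W.map U.subtype = ⊥ := by
    refine hg _ ?_ ?_
    · rintro _ ⟨x, hx, rfl⟩
      refine ⟨_, hW x hx, (apply_eq_compress_of_invariant hA hU heU x ?_).symm⟩
      rw [real_inner_comm, ← inner_orthogonalProjectionOnto, real_inner_comm, hWe x hx]
    · rintro _ ⟨x, -, rfl⟩
      exact heU x x.2
  exact map_injective_of_injective U.injective_subtype (h.trans (Submodule.map_bot _).symm)

end Compression

end SkewInverseEigenvalue

/-! ### Realizing a skew operator on a tree, with rigidity. -/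

namespace SkewInverseEigenvalue

open Module Submodule

/-- In the orthonormal basis `b`, whose vector at `w` is `e`, the skew operator `A` has graph `T`,
and no nonzero skew operator annihilating `e` has a commutator with `A` supported on `T`. -/
structure IsRealization {V : Type u} [Fintype V] (T : SimpleGraph V) (w : V) {E : Type*}
    [NormedAddCommGroup E] [InnerProductSpace ℝ E] (A : E →ₗ[ℝ] E) (e : E)
    (b : OrthonormalBasis V ℝ E) : Prop where
  root : b w = e
  adj : ∀ i j, i ≠ j → (T.Adj i j ↔ inner ℝ (b i) (A (b j)) ≠ 0)
  rigid : ∀ K : E →ₗ[ℝ] E, IsSkew K → K e = 0 →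
    (∀ i j, i ≠ j → ¬T.Adj i j → inner ℝ (b i) (K (A (b j)) - A (K (b j))) = 0) → K = 0

/-- Every skew operator with a cyclic unit vector `e` is realized on `T` with `e` placed
at `w`. -/
def Realizable {V : Type u} (T : SimpleGraph V) (w : V) : Prop :=
  ∀ (_ : Fintype V) (E : Type) [NormedAddCommGroup E] [InnerProductSpace ℝ E] [FiniteDimensional ℝ E]
    (A : E →ₗ[ℝ] E) (e : E), IsSkew A → Generates A e → ‖e‖ = 1 → finrank ℝ E = Fintype.card V →
    ∃ b : OrthonormalBasis V ℝ E, IsRealization T w A e b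

section Glue

variable {V : Type u} {T : SimpleGraph V} {w : V}

theorem eq_or_exists_mem_component (x : V) :
    w = x ∨ ∃ (c : (deleteVertex T w).ConnectedComponent) (y : c), x = y.1.1 := by
  by_cases h : x = w
  · exact Or.inl h.symm
  · exact Or.inr ⟨(deleteVertex T w).connectedComponentMk ⟨x, h⟩, ⟨⟨x, h⟩, rfl⟩, rfl⟩

theorem eq_component_of_adj {c d : (deleteVertex T w).ConnectedComponent} {x : c} {y : d}
    (h : T.Adj x.1.1 y.1.1) : c = d := by
  have hx : (deleteVertex T w).connectedComponentMk x.1 = c := x.2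
  have hy : (deleteVertex T w).connectedComponentMk y.1 = d := y.2
  rw [← hx, ← hy]
  exact SimpleGraph.ConnectedComponent.connectedComponentMk_eq_of_adj h

theorem eq_component_of_eq {c d : (deleteVertex T w).ConnectedComponent} {x : c} {y : d}
    (h : x.1.1 = y.1.1) : c = d := by
  have hx : (deleteVertex T w).connectedComponentMk x.1 = c := x.2
  have hy : (deleteVertex T w).connectedComponentMk y.1 = d := y.2
  rw [← hx, ← hy, Subtype.ext h]

theorem sum_card_components [Fintype V] [Fintype (deleteVertex T w).ConnectedComponent] :
    ∑ c : (deleteVertex T w).ConnectedComponent, c.supp.ncard + 1 = Fintype.card V := by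
  classical
  have h := Fintype.card_congr
    (Equiv.sigmaFiberEquiv (deleteVertex T w).connectedComponentMk)
  rw [Fintype.card_sigma, Fintype.card_subtype_compl, Fintype.card_subtype_eq] at h
  have hpos : 0 < Fintype.card V := Fintype.card_pos_iff.2 ⟨w⟩
  have h2 : ∑ c : (deleteVertex T w).ConnectedComponent, c.supp.ncard =
      ∑ c : (deleteVertex T w).ConnectedComponent,
        Fintype.card {x // (deleteVertex T w).connectedComponentMk x = c} := by
    refine Finset.sum_congr rfl fun c _ => ?_
    rw [← Nat.card_eq_fintype_card, ← Nat.card_coe_set_eq]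
    rfl
  omega

variable {E : Type*} [NormedAddCommGroup E] [InnerProductSpace ℝ E]
  {F : (deleteVertex T w).ConnectedComponent → Submodule ℝ E}

open Classical in
/-- The family on `V` that has value `e` at `w` and agrees with `g c` on the component `c`
of `T(w)`. -/
noncomputable def glue (e : E)
    (g : ∀ c : (deleteVertex T w).ConnectedComponent, c → F c) (x : V) : E :=
  if h : x = w then e
  else g ((deleteVertex T w).connectedComponentMk ⟨x, h⟩) ⟨⟨x, h⟩, rfl⟩

theorem glue_self (e : E) (g : ∀ c : (deleteVertex T w).ConnectedComponent, c → F c) :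
    glue e g w = e := dif_pos rfl

theorem glue_coe (e : E) (g : ∀ c : (deleteVertex T w).ConnectedComponent, c → F c)
    (c : (deleteVertex T w).ConnectedComponent) (y : c) : glue e g y.1.1 = g c y := by
  obtain ⟨⟨y, hyw⟩, hy⟩ := y
  have hc : (deleteVertex T w).connectedComponentMk ⟨y, hyw⟩ = c := hy
  subst hc
  exact dif_neg hyw

theorem orthonormal_glue {e : E} (he : ‖e‖ = 1)
    {g : ∀ c : (deleteVertex T w).ConnectedComponent, c → F c} (hg : ∀ c, Orthonormal ℝ (g c))
    (heF : ∀ c, ∀ x ∈ F c, inner ℝ e x = 0) (hF : ∀ c d, c ≠ d → F c ⟂ F d) :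
    Orthonormal ℝ (glue e g) := by
  refine ⟨fun x => ?_, fun x y hxy => ?_⟩
  · rcases eq_or_exists_mem_component (T := T) (w := w) x with rfl | ⟨c, x, rfl⟩
    · rwa [glue_self]
    · rw [glue_coe]
      exact (hg c).1 x
  · rcases eq_or_exists_mem_component (T := T) (w := w) x with rfl | ⟨c, x, rfl⟩ <;>
      rcases eq_or_exists_mem_component (T := T) (w := w) y with rfl | ⟨d, y, rfl⟩
    · exact absurd rfl hxy
    · rw [glue_self, glue_coe]
      exact heF d _ (g d y).2
    · rw [glue_self, glue_coe, real_inner_comm]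
      exact heF c _ (g c x).2
    · rw [glue_coe, glue_coe]
      by_cases hcd : c = d
      · subst hcd
        exact (hg c).2 fun h => hxy (h ▸ rfl)
      · exact (isOrtho_iff_inner_eq.1 (hF c d hcd)) _ (g c x).2 _ (g d y).2

end Glue

/-- `A` and its compression differ by terms along `e`, which `K` kills and `x` does not see. -/
theorem inner_commutator_deflate {E : Type*} [NormedAddCommGroup E] [InnerProductSpace ℝ E]
    {A : E →ₗ[ℝ] E} {e : E} {K : E →ₗ[ℝ] E} (hK : IsSkew K)
    (hKe : K e = 0) {x y : E} (hx : inner ℝ e x = 0) (hy : inner ℝ e y = 0) :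
    inner ℝ x (K (deflate A e y) - deflate A e (K y)) = inner ℝ x (K (A y) - A (K y)) := by
  have h1 : K (A y) = K (deflate A e y) := by
    conv_lhs => rw [deflate_apply_of_inner_eq_zero A hy, map_add, map_smul, hKe, smul_zero,
      add_zero]
  have h2 : inner ℝ x (A (K y)) = inner ℝ x (deflate A e (K y)) := by
    have h : inner ℝ e (K y) = 0 := by
      rw [← neg_eq_zero, ← hK, hKe, inner_zero_left]
    conv_lhs => rw [deflate_apply_of_inner_eq_zero A h, inner_add_right, inner_smul_right,
      real_inner_comm e x, hx, mul_zero, add_zero]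
  rw [inner_sub_right, inner_sub_right, h1, h2]

theorem OrthonormalBasis.inner_eq_zero_of_forall {ι E : Type*} [Fintype ι] [NormedAddCommGroup E]
    [InnerProductSpace ℝ E] (b : OrthonormalBasis ι ℝ E) {x : E}
    (h : ∀ i, inner ℝ (b i) x = 0) : x = 0 :=
  b.repr.map_eq_zero_iff.1 (by ext i; simpa [b.repr_apply_apply] using h i)

/-- The recursive step, from all that it needs: at most one odd component, and exactly one neighbor
`u c` of `w` in each component `c`. A single vertex is the case without components. -/
theorem Realizable.of_components {V : Type u} (T : SimpleGraph V) (w : V)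
    (hodd : (deleteVertex T w).oddComponents.Subsingleton)
    (u : ∀ c : (deleteVertex T w).ConnectedComponent, c)
    (hu : ∀ c, T.Adj w (u c).1.1)
    (hu' : ∀ (c : (deleteVertex T w).ConnectedComponent) (x : c), T.Adj w x.1.1 → x = u c)
    (ih : ∀ c : (deleteVertex T w).ConnectedComponent, Realizable c.toSimpleGraph (u c)) :
    Realizable T w := by
  classical
  intro _ E _ _ _ A e hA hg he hdim
  have : Fintype (deleteVertex T w).ConnectedComponent := Fintype.ofFinite _
  have : ∀ c : (deleteVertex T w).ConnectedComponent, Fintype c := fun c => Fintype.ofFinite _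
  set M := deflate A e
  obtain ⟨F, hF, hFo⟩ := (hA.deflate (e := e)).exists_invariant_family Finset.univ
    (fun c : (deleteVertex T w).ConnectedComponent => c.supp.ncard)
    (fun c _ d _ hc hd => hodd hc hd) (ℝ ∙ e)ᗮ
    (fun x _ => mem_orthogonal_singleton_iff_inner_right.2 (inner_deflate hA he x)) (by
      have h1 := finrank_add_finrank_orthogonal (ℝ ∙ e)
      rw [finrank_span_singleton (norm_ne_zero_iff.1 (he ▸ one_ne_zero))] at h1
      have h2 := sum_card_components (T := T) (w := w)
      omega)
  have heF : ∀ c, ∀ x ∈ F c, inner ℝ e x = 0 := fun c x hx =>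
    mem_orthogonal_singleton_iff_inner_right.1 ((hF c (Finset.mem_univ c)).1 hx)
  have hFM : ∀ c, ∀ x ∈ F c, M x ∈ F c := fun c => (hF c (Finset.mem_univ c)).2.1
  have hFo' : ∀ c d, c ≠ d → F c ⟂ F d := fun c d =>
    hFo c (Finset.mem_univ c) d (Finset.mem_univ d)
  have hFdim : ∀ c, finrank ℝ (F c) = Fintype.card c := fun c => by
    rw [(hF c (Finset.mem_univ c)).2.2, ← Nat.card_eq_fintype_card, ← Nat.card_coe_set_eq]
    rfl
  -- `β c` is the part of `A e` in `F c`. With its direction placed at `u c`, the vertex `w` is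
  -- joined to no other vertex of `c`.
  let β : ∀ c, F c := fun c => (F c).orthogonalProjectionOnto (A e)
  have hβg : ∀ c, Generates (compress (F c) A) (β c) := fun c =>
    hg.compress hA (hFM c) (heF c)
  have hβ0 : ∀ c, ‖β c‖ ≠ 0 := fun c => by
    have : Nonempty c := ⟨u c⟩
    have : Nontrivial (F c) := nontrivial_of_finrank_pos (hFdim c ▸ Fintype.card_pos)
    exact norm_ne_zero_iff.2 (hβg c).ne_zero
  have hb : ∀ c : (deleteVertex T w).ConnectedComponent, ∃ b : OrthonormalBasis c ℝ (F c), IsRealization c.toSimpleGraph (u c)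
      (compress (F c) A) (‖β c‖⁻¹ • β c) b := fun c =>
    ih c _ (F c) _ _ (hA.compress (F c)) ((hβg c).smul (inv_ne_zero (hβ0 c)))
      (by rw [norm_smul, norm_inv, norm_norm, inv_mul_cancel₀ (hβ0 c)]) (hFdim c)
  choose g hgr using hb
  have hon := orthonormal_glue he (fun c => (g c).orthonormal) heF hFo'
  have : Nonempty V := ⟨w⟩
  let f : OrthonormalBasis V ℝ E :=
    (basisOfOrthonormalOfCardEqFinrank hon hdim.symm).toOrthonormalBasis (by
      rwa [coe_basisOfOrthonormalOfCardEqFinrank])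
  have hf : ∀ x, f x = glue e (fun c => g c) x := fun x => by simp [f]
  have hfw : f w = e := (hf w).trans (glue_self _ _)
  have hfc : ∀ (c : (deleteVertex T w).ConnectedComponent) (y : c), f y.1.1 = g c y := fun c y => (hf _).trans (glue_coe _ _ _ _)
  have hroot : ∀ (c : (deleteVertex T w).ConnectedComponent) (y : c), inner ℝ (f y.1.1) (A e) = if y = u c then ‖β c‖ else 0 := by
    intro c y
    have h1 : β c = ‖β c‖ • g c (u c) := by
      rw [(hgr c).root, smul_smul, mul_inv_cancel₀ (hβ0 c), one_smul]
    rw [hfc, ← inner_orthogonalProjectionOnto]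
    change inner ℝ (g c y) (β c) = _
    conv_lhs => rw [h1]
    rw [inner_smul_right, (g c).inner_eq_ite, mul_ite, mul_one, mul_zero]
  have hadjw : ∀ j, w ≠ j → (T.Adj w j ↔ inner ℝ (f j) (A e) ≠ 0) := by
    intro j hj
    rcases eq_or_exists_mem_component (T := T) (w := w) j with rfl | ⟨c, y, rfl⟩
    · exact absurd rfl hj
    rw [hroot]
    by_cases hy : y = u c
    · simpa [hy, hu] using hβ0 c
    · simpa [hy] using fun h => hy (hu' c y h)
  have hblock : ∀ c d, c ≠ d → ∀ x ∈ F c, ∀ y ∈ F d, inner ℝ x (A y) = 0 := by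
    intro c d hcd x hx y hy
    rw [deflate_apply_of_inner_eq_zero A (heF d y hy), inner_add_right, inner_smul_right,
      real_inner_comm e x, heF c x hx, mul_zero, add_zero]
    exact isOrtho_iff_inner_eq.1 (hFo' c d hcd) x hx _ (hFM d y hy)
  refine ⟨f, hfw, ?_, ?_⟩
  · intro i j hij
    rcases eq_or_exists_mem_component (T := T) (w := w) i with rfl | ⟨c, x, rfl⟩
    · have h := hA e (f j)
      rw [real_inner_comm] at h
      rw [hfw, hadjw j hij, h, neg_ne_zero]
    rcases eq_or_exists_mem_component (T := T) (w := w) j with rfl | ⟨d, y, rfl⟩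
    · rw [hfw, SimpleGraph.adj_comm]
      exact hadjw _ hij.symm
    rw [hfc, hfc]
    by_cases hcd : c = d
    · subst hcd
      rw [← inner_compress, ← (hgr c).adj x y fun h => hij (h ▸ rfl)]
      rfl
    · rw [hblock c d hcd _ (g c x).2 _ (g d y).2]
      simpa using fun h => hcd (eq_component_of_adj h)
  · intro K hK hKe hKA
    have hcomm : ∀ c d, ∀ x ∈ F c, ∀ y ∈ F d, inner ℝ x (K (M y) - M (K y)) =
        inner ℝ x (K (A y) - A (K y)) := fun c d x hx y hy =>
      inner_commutator_deflate hK hKe (heF c x hx) (heF d y hy)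
    -- No edge of `T` joins two components, so the commutator vanishes between their subspaces and
    -- cyclicity removes the block of `K`.
    have hoff : ∀ c d, c ≠ d → ∀ x ∈ F c, ∀ y ∈ F d, inner ℝ x (K y) = 0 := by
      intro c d hcd x hx y hy
      refine hg.inner_eq_zero_of_commutator hA he (hFM d) (heF d) (hFM c) (heF c)
        (hFo' d c hcd.symm) ?_ hx hy
      intro x hx y hy
      rw [hcomm c d x hx y hy]
      let L : E →ₗ[ℝ] E := K ∘ₗ A - A ∘ₗ K
      have h1 : ∀ k, (F c).orthogonalProjectionOnto (L (g d k)) = 0 := fun k =>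
        OrthonormalBasis.inner_eq_zero_of_forall (g c) fun l => by
          rw [inner_orthogonalProjectionOnto, ← hfc, ← hfc]
          refine hKA _ _ ?_ ?_
          · exact fun h => hcd (eq_component_of_eq h)
          · exact fun h => hcd (eq_component_of_adj h)
      have h2 : (F c).orthogonalProjectionOnto.toLinearMap ∘ₗ L ∘ₗ (F d).subtype = 0 :=
        (g d).toBasis.ext fun k => by simpa using h1 k
      have h3 : (F c).orthogonalProjectionOnto (L y) = 0 := LinearMap.congr_fun h2 ⟨y, hy⟩
      have h4 := inner_orthogonalProjectionOnto (F c) ⟨x, hx⟩ (L y)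
      rw [h3, inner_zero_right] at h4
      exact h4.symm
    have hKF : ∀ c, ∀ x ∈ F c, K x ∈ F c := by
      intro c x hx
      rw [← starProjection_eq_self_iff, ← sub_eq_zero]
      refine OrthonormalBasis.inner_eq_zero_of_forall f fun i => ?_
      rw [inner_sub_right]
      rcases eq_or_exists_mem_component (T := T) (w := w) i with rfl | ⟨d, i, rfl⟩
      · rw [hfw, heF c _ (starProjection_apply_mem _ _), zero_sub, ← hK, hKe, inner_zero_left]
      rw [hfc]
      by_cases hcd : d = c
      · subst hcd
        rw [← inner_starProjection_left_eq_right, starProjection_eq_self_iff.2 (g d i).2, sub_self]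
      · rw [hoff d c hcd _ (g d i).2 x hx, sub_zero]
        exact isOrtho_iff_inner_eq.1 (hFo' d c hcd) _ (g d i).2 _ (starProjection_apply_mem _ _)
    have hKc : ∀ c (x : F c), (compress (F c) K x : E) = K x := fun c x =>
      starProjection_eq_self_iff.2 (hKF c x x.2)
    -- The entries of the commutator in column `w` give `K (β c) ⟂ g c k` for `k ≠ u c`; for `k = u
    -- c` orthogonality is the skewness of `K`. So `K` kills the root of each branch, as the
    -- rigidity of the branch requires.
    have hKβ : ∀ c, K (β c) = 0 := by
      intro c
      rw [← hKc, coe_eq_zero]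
      refine OrthonormalBasis.inner_eq_zero_of_forall (g c) fun k => ?_
      rw [inner_compress]
      by_cases hk : k = u c
      · have h1 : β c = ‖β c‖ • g c k := by
          rw [hk, (hgr c).root, smul_smul, mul_inv_cancel₀ (hβ0 c), one_smul]
        rw [h1, coe_smul, map_smul, inner_smul_right, hK.inner_self, mul_zero]
      · have h1 := hKA k.1.1 w k.1.2 fun h => hk (hu' c k h.symm)
        rw [hfw, hKe, map_zero, sub_zero, hfc, ← neg_eq_zero, ← hK] at h1
        rw [← neg_eq_zero, ← hK, ← h1]
        exact inner_orthogonalProjectionOnto (F c) ⟨_, hKF c _ (g c k).2⟩ (A e)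
    have hKA' : ∀ c (x : F c), K (compress (F c) A x) = K (A x) := by
      intro c x
      have h1 := deflate_apply_of_inner_eq_zero A (heF c x x.2)
      have h2 : (compress (F c) A x : E) = M x := by
        change (F c).starProjection (A x) = M x
        rw [h1, map_add, starProjection_eq_self_iff.2 (hFM c x x.2), map_smul,
          (starProjection_apply_eq_zero_iff _).2, smul_zero, add_zero]
        exact fun y hy => (real_inner_comm _ _).trans (heF c y hy)
      rw [h2, h1, map_add, map_smul, hKe, smul_zero, add_zero]
    have hdiag : ∀ c, compress (F c) K = 0 := by
      intro c
      refine (hgr c).rigid _ (hK.compress (F c)) ?_ ?_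
      · rw [map_smul, smul_eq_zero]
        exact Or.inr (Subtype.ext ((hKc c _).trans (hKβ c)))
      · intro i j hij hadj
        have h1 := hKA i.1.1 j.1.1 (fun h => hij (Subtype.ext (Subtype.ext h))) hadj
        rw [hfc, hfc, inner_sub_right] at h1
        rw [inner_sub_right, inner_compress, inner_compress, hKA', hKc, h1]
    refine f.toBasis.ext fun i => ?_
    rw [f.coe_toBasis, LinearMap.zero_apply]
    rcases eq_or_exists_mem_component (T := T) (w := w) i with rfl | ⟨c, i, rfl⟩
    · rw [hfw, hKe]
    · rw [hfc, ← hKc, hdiag, LinearMap.zero_apply, coe_zero]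

end SkewInverseEigenvalue

/-! ### Nearly even branching trees are realizable. -/

namespace SkewInverseEigenvalue

/-- A walk to `w` must leave the component, and the edge by which it leaves can only end at `w`. -/
theorem exists_adj_mem_component {V : Type u} {T : SimpleGraph V} {w : V} (hT : T.Connected)
    (c : (deleteVertex T w).ConnectedComponent) : ∃ x : c, T.Adj w x.1.1 := by
  obtain ⟨y, rfl⟩ := c.exists_rep
  obtain ⟨p⟩ := hT.preconnected y.1 w
  obtain ⟨d, -, ⟨hd, hdc⟩, hd2⟩ := p.exists_boundary_dart
    {x | ∃ h : x ≠ w, (deleteVertex T w).connectedComponentMk ⟨x, h⟩ =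
      (deleteVertex T w).connectedComponentMk y} ⟨y.2, rfl⟩ (fun h => h.1 rfl)
  have hw : d.snd = w := by
    by_contra h
    refine hd2 ⟨h, ?_⟩
    rw [← hdc]
    exact SimpleGraph.ConnectedComponent.connectedComponentMk_eq_of_adj d.adj.symm
  exact ⟨⟨⟨d.fst, hd⟩, hdc⟩, hw ▸ d.adj.symm⟩

/-- The edge from `w` to `x` is a bridge, yet a second neighbor `y` in the same component would give
a detour around it. -/
theorem eq_of_adj_of_mem_component {V : Type u} {T : SimpleGraph V} {w : V} (hT : T.IsAcyclic)
    {c : (deleteVertex T w).ConnectedComponent} {x y : c} (hx : T.Adj w x.1.1)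
    (hy : T.Adj w y.1.1) : x = y := by
  by_contra hxy
  have hb := SimpleGraph.isAcyclic_iff_forall_adj_isBridge.1 hT hx
  rw [SimpleGraph.isBridge_iff] at hb
  apply hb
  have hwy : (T.deleteEdges {s(w, x.1.1)}).Adj w y.1.1 := by
    rw [SimpleGraph.deleteEdges_adj]
    refine ⟨hy, fun h => ?_⟩
    rw [Set.mem_singleton_iff, Sym2.congr_right] at h
    exact hxy (Subtype.ext (Subtype.ext h.symm))
  let φ : deleteVertex T w →g T.deleteEdges {s(w, x.1.1)} :=
    ⟨Subtype.val, fun {a b} h => by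
      rw [SimpleGraph.deleteEdges_adj]
      refine ⟨h, fun h' => ?_⟩
      rw [Set.mem_singleton_iff, Sym2.eq_iff] at h'
      rcases h' with h' | h'
      · exact a.2 h'.1
      · exact b.2 h'.2⟩
  have hyx : (deleteVertex T w).Reachable y.1 x.1 := c.reachable_of_mem_supp y.2 x.2
  exact hwy.reachable.trans (hyx.map φ)

/-- Every nearly even branching tree realizes every skew operator with a cyclic vector placed at
its root. -/
theorem IsNEB.realizable {V : Type u} [Finite V] {T : SimpleGraph V} {w : V} (h : IsNEB T w)
    (hT : T.IsTree) : Realizable T w := by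
  induction h with
  | @single V T w hcard =>
    have hs := (Nat.card_eq_one_iff_unique.1 hcard).1
    have he : IsEmpty (deleteVertex T w).ConnectedComponent :=
      ⟨fun c => c.ind fun x => x.2 (Subsingleton.elim _ _)⟩
    exact Realizable.of_components T w (fun c => he.elim c) he.elim he.elim he.elim he.elim
  | @step V T w _ heven hodd _ ih =>
    have hsub : (deleteVertex T w).oddComponents.Subsingleton := by
      rcases Nat.even_or_odd (Nat.card V) with h | h
      · obtain ⟨c, hc⟩ := Set.ncard_eq_one.1 (heven h)
        rw [hc]
        exact Set.subsingleton_singleton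
      · rw [hodd h]
        exact Set.subsingleton_empty
    choose u hu using exists_adj_mem_component (w := w) hT.connected
    refine Realizable.of_components T w hsub u hu
      (fun c x hx => eq_of_adj_of_mem_component hT.isAcyclic hx (hu c)) fun c => ?_
    have hc : branch T w (u c).1.1 (hu c).ne' = c := (u c).2
    -- The branch at `u c` equals `c` only propositionally, so realizability is transported along
    -- this equality.
    have key : ∀ (d : (deleteVertex T w).ConnectedComponent) (x : c) (y : d), d = c →
        x.1.1 = y.1.1 → Realizable d.toSimpleGraph y → Realizable c.toSimpleGraph x := by
      rintro d x y rfl hxy h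
      obtain rfl : x = y := Subtype.ext (Subtype.ext hxy)
      exact h
    exact key _ _ _ hc rfl (ih _ (hu c) (hT.isAcyclic.of_comap (Function.Embedding.subtype _) |>.isTree_connectedComponent _))

end SkewInverseEigenvalue

/-! ### From the tree to a supergraph, by perturbing the basis. -/

namespace SkewInverseEigenvalue

open Module Submodule

section OrderedEdges

variable {V : Type*} [LinearOrder V]

/-- The edges of a graph on a linearly ordered type, as increasing pairs. -/
abbrev OrderedEdge (H : SimpleGraph V) : Type _ := {p : V × V // p.1 < p.2 ∧ H.Adj p.1 p.2}

noncomputable instance [Finite V] (H : SimpleGraph V) : Fintype (OrderedEdge H) :=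
  Fintype.ofFinite _

theorem OrderedEdge.card_eq (H : SimpleGraph V) :
    Nat.card (OrderedEdge H) = H.edgeSet.ncard := by
  rw [← Nat.card_coe_set_eq]
  refine Nat.card_congr (Equiv.ofBijective (fun p => ⟨s(p.1.1, p.1.2), p.2.2⟩) ⟨?_, ?_⟩)
  · rintro ⟨⟨a, b⟩, hab, h⟩ ⟨⟨c, d⟩, hcd, h'⟩ heq
    have h1 : s(a, b) = s(c, d) := congrArg Subtype.val heq
    rw [Sym2.eq_iff] at h1
    rcases h1 with ⟨rfl, rfl⟩ | ⟨rfl, rfl⟩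
    · rfl
    · exact absurd hab hcd.asymm
  · rintro ⟨z, hz⟩
    induction z with
    | _ a b =>
      rcases (SimpleGraph.Adj.ne hz).lt_or_gt with h | h
      · exact ⟨⟨(a, b), h, hz⟩, rfl⟩
      · exact ⟨⟨(b, a), h, hz.symm⟩, Subtype.ext Sym2.eq_swap⟩

theorem ncard_edgeSet_compl_eq_of_isTree {V : Type*} [Finite V] {T S : SimpleGraph V}
    (hT : T.IsTree) (hS : S.IsTree) : Tᶜ.edgeSet.ncard = Sᶜ.edgeSet.ncard := by
  classical
  have := Fintype.ofFinite V
  have key : ∀ H : SimpleGraph V, H.IsTree →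
      Hᶜ.edgeSet.ncard + Fintype.card V = (⊤ : SimpleGraph V).edgeSet.ncard + 1 := by
    intro H hH
    have h1 : H.edgeSet.ncard + 1 = Fintype.card V := by
      rw [← hH.card_edgeFinset, ← SimpleGraph.coe_edgeFinset, Set.ncard_coe_finset]
    have h2 : Disjoint H.edgeSet Hᶜ.edgeSet :=
      SimpleGraph.disjoint_edgeSet.2 disjoint_compl_right
    have h3 := Set.ncard_union_eq h2
    rw [← SimpleGraph.edgeSet_sup, sup_compl_eq_top] at h3
    omega
  have := key T hT
  have := key S hS
  omega

end OrderedEdges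

variable {V : Type u} [Fintype V] [LinearOrder V] {E : Type*} [NormedAddCommGroup E]
  [InnerProductSpace ℝ E]

/-- The infinitesimal rotation in the plane spanned by `x` and `y`. -/
noncomputable def planeRotation (x y : E) : E →L[ℝ] E :=
  (innerSL ℝ y).smulRight x - (innerSL ℝ x).smulRight y

theorem planeRotation_apply (x y z : E) :
    planeRotation x y z = inner ℝ y z • x - inner ℝ x z • y := rfl

theorem IsSkew.planeRotation (x y : E) : IsSkew (planeRotation x y).toLinearMap := fun a b => by
  simp only [ContinuousLinearMap.coe_coe, planeRotation_apply, inner_sub_left, inner_sub_right,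
    inner_smul_left, inner_smul_right, RCLike.conj_to_real]
  rw [real_inner_comm a y, real_inner_comm a x]
  ring

theorem IsSkew.sum {ι : Type*} (s : Finset ι) {f : ι → E →ₗ[ℝ] E} (hf : ∀ i ∈ s, IsSkew (f i)) :
    IsSkew (∑ i ∈ s, f i) := fun x y => by
  rw [LinearMap.sum_apply, LinearMap.sum_apply, sum_inner, inner_sum, ← Finset.sum_neg_distrib]
  exact Finset.sum_congr rfl fun i hi => hf i hi x y

theorem IsSkew.smul {A : E →ₗ[ℝ] E} (hA : IsSkew A) (c : ℝ) : IsSkew (c • A) := fun x y => by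
  rw [LinearMap.smul_apply, LinearMap.smul_apply, inner_smul_left, inner_smul_right, hA]
  simp

/-- The skew operator whose matrix in the orthonormal basis `b` has the entries `c` above the
diagonal on the edges of `H`, and no other entries above the diagonal. -/
noncomputable def skewOfEdges (b : OrthonormalBasis V ℝ E) (H : SimpleGraph V) :
    (OrderedEdge H → ℝ) →ₗ[ℝ] E →L[ℝ] E :=
  Fintype.linearCombination ℝ fun p : OrderedEdge H => planeRotation (b p.1.1) (b p.1.2)

variable (b : OrthonormalBasis V ℝ E) (H : SimpleGraph V)

theorem skewOfEdges_eq_sum (c : OrderedEdge H → ℝ) :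
    skewOfEdges b H c = ∑ p, c p • planeRotation (b p.1.1) (b p.1.2) :=
  Fintype.linearCombination_apply ..

theorem IsSkew.skewOfEdges (c : OrderedEdge H → ℝ) : IsSkew (skewOfEdges b H c).toLinearMap := by
  rw [skewOfEdges_eq_sum, ContinuousLinearMap.toLinearMap_sum]
  exact IsSkew.sum _ fun p _ => (IsSkew.planeRotation _ _).smul _

theorem skewOfEdges_apply_eq_zero {w : V} (hw : ∀ i, ¬H.Adj i w) (c : OrderedEdge H → ℝ) :
    skewOfEdges b H c (b w) = 0 := by
  rw [skewOfEdges_eq_sum, sum_apply]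
  refine Finset.sum_eq_zero fun p _ => ?_
  have h1 : p.1.1 ≠ w := fun h => hw p.1.2 (h ▸ p.2.2.symm)
  have h2 : p.1.2 ≠ w := fun h => hw p.1.1 (h ▸ p.2.2)
  simp [planeRotation_apply, b.inner_eq_zero h1, b.inner_eq_zero h2]

theorem inner_skewOfEdges (c : OrderedEdge H → ℝ) (q : OrderedEdge H) :
    inner ℝ (b q.1.1) (skewOfEdges b H c (b q.1.2)) = c q := by
  rw [skewOfEdges_eq_sum, sum_apply, inner_sum, Finset.sum_eq_single q]
  · simp [planeRotation_apply, inner_smul_right, b.inner_eq_zero q.2.1.ne]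
  · intro p _ hpq
    obtain ⟨⟨i, j⟩, hij, hadj⟩ := p
    obtain ⟨⟨k, l⟩, hkl, hadj'⟩ := q
    simp only [smul_apply, planeRotation_apply, inner_smul_right,
      inner_sub_right, b.inner_eq_ite]
    have h1 : ¬(j = l ∧ k = i) := by
      rintro ⟨rfl, rfl⟩
      exact hpq rfl
    have h2 : ¬(i = l ∧ k = j) := by
      rintro ⟨rfl, rfl⟩
      exact hij.asymm hkl
    rw [mul_ite, mul_ite]
    grind
  · exact fun h => absurd (Finset.mem_univ q) h

theorem skewOfEdges_injective : Function.Injective (skewOfEdges b H) := by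
  rw [← LinearMap.ker_eq_bot, LinearMap.ker_eq_bot']
  intro c hc
  funext q
  rw [← inner_skewOfEdges b H c q, hc]
  simp

variable [FiniteDimensional ℝ E]

theorem exp_apply_eq_self {K : E →L[ℝ] E} {e : E} (h : K e = 0) : NormedSpace.exp K e = e := by
  have h1 := (ContinuousLinearMap.apply ℝ E e).hasSum
    (NormedSpace.exp_series_hasSum_exp' (𝕂 := ℝ) K)
  refine h1.unique ?_
  convert hasSum_single 0 ?_ using 1
  · simp
  · intro n hn
    obtain ⟨m, rfl⟩ := Nat.exists_eq_succ_of_ne_zero hn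
    simp [pow_succ, h]

theorem IsSkew.exp_mem_unitary {K : E →L[ℝ] E} (hK : IsSkew K.toLinearMap) :
    NormedSpace.exp K ∈ unitary (E →L[ℝ] E) := by
  let _ : NormedAlgebra ℚ (E →L[ℝ] E) := NormedAlgebra.restrictScalars ℚ ℝ _
  refine NormedSpace.exp_mem_unitary_of_mem_skewAdjoint ?_
  rw [skewAdjoint.mem_iff, ContinuousLinearMap.star_eq_adjoint]
  symm
  rw [ContinuousLinearMap.eq_adjoint_iff]
  intro x y
  rw [neg_apply, inner_neg_left, neg_eq_iff_eq_neg]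
  exact hK x y

theorem IsRealization.exists_of_le {T G : SimpleGraph V} (hT : T.IsTree) (hTG : T ≤ G) {w : V}
    {A : E →ₗ[ℝ] E} (hA : IsSkew A) {e : E} {b : OrthonormalBasis V ℝ E}
    (hr : IsRealization T w A e b) :
    ∃ b' : OrthonormalBasis V ℝ E, b' w = e ∧
      ∀ i j, i ≠ j → (G.Adj i j ↔ inner ℝ (b' i) (A (b' j)) ≠ 0) := by
  classical
  -- The edges of `S` are the pairs avoiding `w`, which parametrize the skew `K` with `K e = 0`. As
  -- the star is a tree, `S` has as many edges as `Tᶜ`.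
  set S : SimpleGraph V := (SimpleGraph.starGraph w)ᶜ with hS
  have hSw : ∀ i, ¬S.Adj i w := by
    intro i
    simp only [hS, SimpleGraph.compl_adj, SimpleGraph.starGraph_adj]
    tauto
  let κ : (OrderedEdge S → ℝ) →L[ℝ] E →L[ℝ] E := (skewOfEdges b S).toContinuousLinearMap
  let A' : E →L[ℝ] E := A.toContinuousLinearMap
  let Ψ : V → V → (OrderedEdge S → ℝ) → ℝ := fun i j c =>
    inner ℝ (NormedSpace.exp (κ c) (b i)) (A' (NormedSpace.exp (κ c) (b j)))
  have hΨ0 : ∀ i j, Ψ i j 0 = inner ℝ (b i) (A (b j)) := by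
    intro i j
    simp only [Ψ, map_zero, NormedSpace.exp_zero]
    rfl
  have hexp : ∀ i, HasStrictFDerivAt (fun c => NormedSpace.exp (κ c) (b i))
      ((ContinuousLinearMap.apply ℝ E (b i)).comp κ) 0 := by
    intro i
    have h1 : HasStrictFDerivAt (NormedSpace.exp : (E →L[ℝ] E) → _)
        (1 : (E →L[ℝ] E) →L[ℝ] (E →L[ℝ] E)) (κ 0) := by
      rw [map_zero]
      exact hasStrictFDerivAt_exp_zero
    have h2 := h1.comp (0 : OrderedEdge S → ℝ) κ.hasStrictFDerivAt
    exact (ContinuousLinearMap.apply ℝ E (b i)).hasStrictFDerivAt.comp _ h2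
  -- With `K = κ c`, this derivative is `⟨b i, (A K - K A) (b j)⟩`, so rigidity says that the
  -- derivative on the non-edges of `T` is injective.
  let D : V → V → (OrderedEdge S → ℝ) →L[ℝ] ℝ := fun i j =>
    fderivInnerCLM ℝ (b i, A' (b j)) ∘SL
      ((ContinuousLinearMap.apply ℝ E (b i)).comp κ).prod
        (A'.comp ((ContinuousLinearMap.apply ℝ E (b j)).comp κ))
  have hD : ∀ i j c, D i j c = inner ℝ (b i) (A (κ c (b j))) + inner ℝ (κ c (b i)) (A (b j)) :=
    fun i j c => rfl
  have hΨ : ∀ i j, HasStrictFDerivAt (Ψ i j) (D i j) 0 := by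
    intro i j
    have h := (hexp i).inner ℝ (A'.hasStrictFDerivAt.comp 0 (hexp j))
    simpa [D, Ψ] using h
  let Φ : (OrderedEdge S → ℝ) → OrderedEdge Tᶜ → ℝ := fun c q => Ψ q.1.1 q.1.2 c
  let L : (OrderedEdge S → ℝ) →L[ℝ] (OrderedEdge Tᶜ → ℝ) :=
    ContinuousLinearMap.pi fun q => D q.1.1 q.1.2
  have hΦ : HasStrictFDerivAt Φ L 0 := hasStrictFDerivAt_pi.2 fun q => hΨ q.1.1 q.1.2
  have hLinj : Function.Injective L.toLinearMap := by
    rw [← LinearMap.ker_eq_bot, LinearMap.ker_eq_bot']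
    intro c hc
    have hK : IsSkew (κ c).toLinearMap := IsSkew.skewOfEdges b S c
    have hswap : ∀ i j, D j i c = -D i j c := by
      intro i j
      have h1 := hA (κ c (b j)) (b i)
      have h2 := hA (κ c (b i)) (b j)
      rw [real_inner_comm] at h1 h2
      rw [hD, hD]
      linarith
    have hz : ∀ i j, i ≠ j → ¬T.Adj i j → D i j c = 0 := by
      intro i j hij hadj
      rcases hij.lt_or_gt with h | h
      · exact congrFun hc ⟨(i, j), h, hij, hadj⟩
      · rw [hswap j i, neg_eq_zero]
        exact congrFun hc ⟨(j, i), h, hij.symm, fun h => hadj h.symm⟩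
    have h0 : (κ c).toLinearMap = 0 := by
      refine hr.rigid _ hK ?_ ?_
      · rw [← hr.root]
        exact skewOfEdges_apply_eq_zero b S hSw c
      · intro i j hij hadj
        have h1 := hz i j hij hadj
        rw [hD] at h1
        have h2 := hK (b i) (A (b j))
        rw [inner_sub_right]
        change inner ℝ (κ c (b i)) (A (b j)) = -inner ℝ (b i) (κ c (A (b j))) at h2
        change inner ℝ (b i) (κ c (A (b j))) - inner ℝ (b i) (A (κ c (b j))) = 0
        linarith
    refine skewOfEdges_injective b S ?_
    rw [map_zero]
    ext x
    exact LinearMap.congr_fun h0 x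
  have hsurj : L.toLinearMap.range = ⊤ := by
    rw [LinearMap.range_eq_top]
    refine (LinearMap.injective_iff_surjective_of_finrank_eq_finrank ?_).1 hLinj
    rw [Module.finrank_fintype_fun_eq_card, Module.finrank_fintype_fun_eq_card,
      ← Nat.card_eq_fintype_card, ← Nat.card_eq_fintype_card, OrderedEdge.card_eq,
      OrderedEdge.card_eq]
    exact ncard_edgeSet_compl_eq_of_isTree (SimpleGraph.isTree_starGraph w) hT
  have hmap := hΦ.map_nhds_eq_of_surj hsurj
  have hΦ0 : Φ 0 = 0 := by
    funext q
    by_contra h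
    exact q.2.2.2 ((hr.adj _ _ q.2.1.ne).2 (by rwa [← hΨ0]))
  have hN : ∀ᶠ c in nhds (0 : OrderedEdge S → ℝ), ∀ i j, T.Adj i j → Ψ i j c ≠ 0 := by
    simp only [Filter.eventually_all]
    intro i j hij
    refine (hΨ i j).continuousAt.eventually_ne ?_
    rw [hΨ0]
    exact (hr.adj i j hij.ne).1 hij
  have himg := Filter.image_mem_map (m := Φ) hN
  rw [hmap, hΦ0] at himg
  -- Target values at the non-edges of `T`: a common small `t ≠ 0` on the edges of `G` and zero
  -- elsewhere. Near the origin the entries on `T` stay nonzero.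
  let γ : ℝ → OrderedEdge Tᶜ → ℝ := fun t q => if G.Adj q.1.1 q.1.2 then t else 0
  have hγ : Filter.Tendsto γ (nhds 0) (nhds 0) := by
    have : Continuous γ := continuous_pi fun q => by
      by_cases h : G.Adj q.1.1 q.1.2 <;> simp only [γ, h, if_true, if_false] <;> fun_prop
    convert this.tendsto 0
    funext q
    simp [γ]
  have hev : ∀ᶠ t in nhdsWithin (0 : ℝ) {0}ᶜ, γ t ∈ Φ '' {c | ∀ i j, T.Adj i j → Ψ i j c ≠ 0} :=
    (hγ.mono_left nhdsWithin_le_nhds) himg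
  obtain ⟨t, ⟨c, hc, hct⟩, ht⟩ := (hev.and self_mem_nhdsWithin).exists
  have hU := (IsSkew.skewOfEdges b S c).exp_mem_unitary
  let b' := b.map (Unitary.linearIsometryEquiv ⟨_, hU⟩)
  have hb' : ∀ i j, inner ℝ (b' i) (A (b' j)) = Ψ i j c := fun i j => by
    simp only [b', OrthonormalBasis.map_apply]
    rfl
  have hlt : ∀ i j, i < j → (G.Adj i j ↔ Ψ i j c ≠ 0) := by
    intro i j hij
    by_cases hadj : T.Adj i j
    · exact iff_of_true (hTG hadj) (hc i j hadj)
    · have h := congrFun hct ⟨(i, j), hij, hij.ne, hadj⟩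
      change Ψ i j c = if G.Adj i j then t else 0 at h
      rw [h]
      by_cases hG : G.Adj i j
      · simpa [hG] using ht
      · simp [hG]
  refine ⟨b', ?_, ?_⟩
  · rw [← hr.root]
    simp only [b', OrthonormalBasis.map_apply]
    exact exp_apply_eq_self (skewOfEdges_apply_eq_zero b S hSw c)
  · intro i j hij
    rcases hij.lt_or_gt with h | h
    · rw [hb', hlt i j h]
    · have h1 := hA (b' j) (b' i)
      rw [real_inner_comm] at h1
      rw [h1, neg_ne_zero, hb', SimpleGraph.adj_comm, hlt j i h]

end SkewInverseEigenvalue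

/-! ### Weights from interlacing, and spectra from eigenvectors. -/

namespace SkewInverseEigenvalue

open Module

section Weights

-- Both polynomials are monic of degree `n + 1`, and their next coefficients are minus the two equal
-- sums, so two leading terms cancel.
open Polynomial in
theorem degree_X_mul_nodal_sub_nodal_lt {n : ℕ} (hn : 1 ≤ n) {lam : Fin (n + 1) → ℝ}
    {mu : Fin n → ℝ} (h : ∑ j, lam j = ∑ k, mu k) :
    (X * Lagrange.nodal Finset.univ mu - Lagrange.nodal Finset.univ lam : ℝ[X]).degree <
      (n : WithBot ℕ) := by
  have hP : (Lagrange.nodal Finset.univ lam).degree = ((n + 1 : ℕ) : WithBot ℕ) := by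
    rw [Lagrange.degree_nodal, Finset.card_univ, Fintype.card_fin]
  have hQ : (X * Lagrange.nodal Finset.univ mu : ℝ[X]).degree = ((n + 1 : ℕ) : WithBot ℕ) := by
    rw [degree_mul, degree_X, Lagrange.degree_nodal, Finset.card_univ, Fintype.card_fin, add_comm]
    rfl
  have hmP : (Lagrange.nodal Finset.univ lam).Monic := Lagrange.nodal_monic
  have hmQ : (X * Lagrange.nodal Finset.univ mu : ℝ[X]).Monic :=
    monic_X.mul Lagrange.nodal_monic
  have hlt := degree_sub_lt_left (hQ.trans hP.symm) hmQ.ne_zero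
    (hmQ.leadingCoeff.trans hmP.leadingCoeff.symm)
  rw [hQ, degree_lt_iff_coeff_zero] at hlt
  rw [degree_lt_iff_coeff_zero]
  intro m hm
  rcases hm.eq_or_lt with rfl | hm
  · have h1 := prod_X_sub_C_coeff_card_pred Finset.univ lam (by simp)
    have h2 := prod_X_sub_C_coeff_card_pred Finset.univ mu (by simpa using Nat.pos_of_ne_zero (Nat.one_le_iff_ne_zero.1 hn))
    rw [Finset.card_univ, Fintype.card_fin] at h1 h2
    obtain ⟨m, rfl⟩ := Nat.exists_eq_add_of_le' hn
    rw [coeff_sub, coeff_X_mul]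
    simp only [Nat.add_sub_cancel] at h1 h2
    rw [Lagrange.nodal, Lagrange.nodal, h1, h2, h]
    ring
  · exact hlt m hm

variable {n : ℕ} {lam : Fin (n + 1) → ℝ} {mu : Fin n → ℝ}

theorem strictMono_of_interlace
    (hinterlace : ∀ k : Fin n, lam k.castSucc < mu k ∧ mu k < lam k.succ) :
    StrictMono lam :=
  Fin.strictMono_iff_lt_succ.2 fun k => (hinterlace k).1.trans (hinterlace k).2

theorem lt_castSucc_of_lt
    (hinterlace : ∀ k : Fin n, lam k.castSucc < mu k ∧ mu k < lam k.succ)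
    {k l : Fin n} (h : k < l) : mu k < lam l.castSucc :=
  (hinterlace k).2.trans_le ((strictMono_of_interlace hinterlace).monotone
    (Fin.succ_le_castSucc_iff.2 h))

theorem strictMono_mu_of_interlace
    (hinterlace : ∀ k : Fin n, lam k.castSucc < mu k ∧ mu k < lam k.succ) :
    StrictMono mu := fun _ l h =>
  (lt_castSucc_of_lt hinterlace h).trans (hinterlace l).1

theorem ne_of_interlace
    (hinterlace : ∀ k : Fin n, lam k.castSucc < mu k ∧ mu k < lam k.succ)
    (j : Fin (n + 1)) (k : Fin n) : lam j ≠ mu k := by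
  rcases le_or_gt j k.castSucc with h | h
  · exact (((strictMono_of_interlace hinterlace).monotone h).trans_lt (hinterlace k).1).ne
  · exact ((hinterlace k).2.trans_le ((strictMono_of_interlace hinterlace).monotone
      (Fin.castSucc_lt_iff_succ_le.1 h))).ne'

/-- Pairing `mu k - mu l` with `mu k - lam l.castSucc` for `l ≠ k` gives positive quotients. Of the
two factors left over, only the one with the largest `lam` is negative. -/
theorem nodalWeight_mul_eval_nodal_neg
    (hinterlace : ∀ k : Fin n, lam k.castSucc < mu k ∧ mu k < lam k.succ)
    (k : Fin n) :
    Lagrange.nodalWeight Finset.univ mu k * (Lagrange.nodal Finset.univ lam).eval (mu k) < 0 := by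
  have hmono := strictMono_of_interlace hinterlace
  have hmu := strictMono_mu_of_interlace hinterlace
  have h1 : mu k - lam (Fin.last n) < 0 :=
    sub_neg.2 ((hinterlace k).2.trans_le (hmono.monotone (Fin.le_last _)))
  have h2 : 0 < mu k - lam k.castSucc := sub_pos.2 (hinterlace k).1
  have h3 : 0 < ∏ l ∈ Finset.univ.erase k, (mu k - mu l)⁻¹ * (mu k - lam l.castSucc) := by
    refine Finset.prod_pos fun l hl => ?_
    rcases (Finset.ne_of_mem_erase hl).lt_or_gt with h | h
    · exact mul_pos (inv_pos.2 (sub_pos.2 (hmu h)))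
        (sub_pos.2 ((hinterlace l).1.trans (hmu h)))
    · exact mul_pos_of_neg_of_neg (inv_lt_zero.2 (sub_neg.2 (hmu h)))
        (sub_neg.2 (lt_castSucc_of_lt hinterlace h))
  rw [Finset.prod_mul_distrib] at h3
  rw [Lagrange.eval_nodal, Fin.prod_univ_castSucc, Lagrange.nodalWeight,
    ← Finset.mul_prod_erase _ _ (Finset.mem_univ k)]
  have h4 := mul_neg_of_pos_of_neg (mul_pos h3 h2) h1
  calc _ = _ := by ring
    _ < 0 := h4

theorem exists_interlacing_weights
    (hinterlace : ∀ k : Fin n, lam k.castSucc < mu k ∧ mu k < lam k.succ)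
    (hn : 1 ≤ n) (hlam : ∀ j : Fin (n + 1), lam j = -lam j.rev)
    (hmu : ∀ k : Fin n, mu k = -mu k.rev) :
    ∃ w : Fin n → ℝ, (∀ k, 0 < w k) ∧ (∀ k, w k.rev = w k) ∧
      ∀ j, lam j = ∑ k, w k / (lam j - mu k) := by
  have hs1 : ∑ j, lam j = 0 := by
    have h := Equiv.sum_comp Fin.revPerm lam
    have h' : ∑ j, lam j = -∑ j : Fin (n + 1), lam j.rev := by
      rw [← Finset.sum_neg_distrib]
      exact Finset.sum_congr rfl fun j _ => (hlam j)
    simp only [Fin.revPerm_apply] at h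
    linarith
  have hs2 : ∑ j, mu j = 0 := by
    have h := Equiv.sum_comp Fin.revPerm mu
    have h' : ∑ j, mu j = -∑ j : Fin n, mu j.rev := by
      rw [← Finset.sum_neg_distrib]
      exact Finset.sum_congr rfl fun j _ => hmu j
    simp only [Fin.revPerm_apply] at h
    linarith
  let P := Lagrange.nodal Finset.univ lam
  let Q := Lagrange.nodal Finset.univ mu
  -- By Lagrange interpolation of `X * Q - P` at the `mu k`, these are the residues of `(X * Q - P)
  -- / Q`; at `lam j`, where `P` vanishes, that quotient is `lam j`.
  let w : Fin n → ℝ := fun k => -(Lagrange.nodalWeight Finset.univ mu k * P.eval (mu k))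
  have hw : ∀ k, 0 < w k := fun k =>
    neg_pos.2 (nodalWeight_mul_eval_nodal_neg hinterlace k)
  have hsum : ∀ j, lam j = ∑ k, w k / (lam j - mu k) := by
    intro j
    have h1 := Lagrange.eq_interpolate (s := Finset.univ)
      (strictMono_mu_of_interlace hinterlace).injective.injOn
      (f := Polynomial.X * Q - P) (by
        rw [Finset.card_univ, Fintype.card_fin]
        exact degree_X_mul_nodal_sub_nodal_lt hn (hs1.trans hs2.symm))
    have h2 := congrArg (Polynomial.eval (lam j)) h1
    have hPj : P.eval (lam j) = 0 := Lagrange.eval_nodal_at_node (Finset.mem_univ j)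
    have hQj : Q.eval (lam j) ≠ 0 :=
      Lagrange.eval_nodal_not_at_node fun k _ => ne_of_interlace hinterlace j k
    rw [Lagrange.eval_interpolate_not_at_node _ fun k _ => ne_of_interlace hinterlace j k,
      Polynomial.eval_sub, Polynomial.eval_mul, Polynomial.eval_X, hPj, sub_zero, mul_comm] at h2
    refine (mul_left_cancel₀ hQj h2).trans ?_
    refine Finset.sum_congr rfl fun k _ => ?_
    have hQk : Q.eval (mu k) = 0 := Lagrange.eval_nodal_at_node (Finset.mem_univ k)
    rw [Polynomial.eval_sub, Polynomial.eval_mul, hQk, mul_zero, zero_sub]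
    simp only [w]
    ring
  -- The reversed weights solve the same equations, so averaging yields symmetric weights without a
  -- uniqueness argument.
  refine ⟨fun k => (w k + w k.rev) / 2, fun k => by linarith [hw k, hw k.rev],
    fun k => by simp only [Fin.rev_rev, add_comm], fun j => ?_⟩
  have hrev : lam j = ∑ k, w k.rev / (lam j - mu k) := by
    have h1 := hsum j.rev
    rw [← Equiv.sum_comp Fin.revPerm] at h1
    rw [hlam j]
    conv_lhs => rw [h1]
    rw [← Finset.sum_neg_distrib]
    refine Finset.sum_congr rfl fun k _ => ?_
    rw [Fin.revPerm_apply, ← div_neg, hmu k]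
    congr 1
    ring
  calc lam j = (lam j + lam j) / 2 := by ring
    _ = (∑ k, w k / (lam j - mu k) + ∑ k, w k.rev / (lam j - mu k)) / 2 := by
      rw [← hsum, ← hrev]
    _ = _ := by
      rw [← Finset.sum_add_distrib, Finset.sum_div]
      refine Finset.sum_congr rfl fun k _ => by ring

end Weights

section Spectrum

open Matrix

/-- `ζ` is an eigenvalue of the real matrix `N`, witnessed by a complex eigenvector. -/
def HasComplexEigenvalue {ι : Type*} [Fintype ι] (N : Matrix ι ι ℝ) (ζ : ℂ) : Prop :=
  ∃ z : ι → ℂ, z ≠ 0 ∧ N.map (fun a : ℝ => (a : ℂ)) *ᵥ z = ζ • z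

theorem HasComplexEigenvalue.conj {ι κ : Type*} [Fintype ι] [DecidableEq ι] [Fintype κ]
    {N : Matrix ι ι ℝ} {ζ : ℂ} (h : HasComplexEigenvalue N ζ) {B : Matrix ι κ ℝ}
    (hB : B * Bᵀ = 1) : HasComplexEigenvalue (Bᵀ * N * B) ζ := by
  obtain ⟨z, hz, hN⟩ := h
  have hBB : B.map (fun a : ℝ => (a : ℂ)) * Bᵀ.map (fun a : ℝ => (a : ℂ)) = 1 := by
    refine (Matrix.map_mul (f := Complex.ofRealHom)).symm.trans ?_
    rw [hB]
    exact Matrix.map_one _ Complex.ofReal_zero Complex.ofReal_one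
  have hBNB : (Bᵀ * N * B).map (fun a : ℝ => (a : ℂ)) = Bᵀ.map (fun a : ℝ => (a : ℂ)) *
      N.map (fun a : ℝ => (a : ℂ)) * B.map (fun a : ℝ => (a : ℂ)) :=
    (Matrix.map_mul (f := Complex.ofRealHom)).trans
      (congrArg (· * _) (Matrix.map_mul (f := Complex.ofRealHom)))
  refine ⟨Bᵀ.map (fun a : ℝ => (a : ℂ)) *ᵥ z, fun h0 => hz ?_, ?_⟩
  · rw [← Matrix.one_mulVec z, ← hBB, ← Matrix.mulVec_mulVec, h0, Matrix.mulVec_zero]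
  · rw [hBNB, Matrix.mulVec_mulVec, Matrix.mul_assoc, hBB, Matrix.mul_one,
      ← Matrix.mulVec_mulVec, hN, Matrix.mulVec_smul]

/-- As many distinct eigenvalues as the size of the matrix exhaust the roots of its characteristic
polynomial. -/
theorem eigenvalueSet_eq_range {κ : Type u} [Fintype κ] [DecidableEq κ] {ι : Type*} [Fintype ι]
    {N : Matrix κ κ ℝ} {f : ι → ℂ} (hf : Function.Injective f)
    (hcard : Fintype.card ι = Fintype.card κ) (h : ∀ i, HasComplexEigenvalue N (f i)) :
    eigenvalueSet N = Set.range f := by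
  classical
  symm
  let N' := N.map (fun a : ℝ => (a : ℂ))
  have hroots : eigenvalueSet N = (N'.charpoly.roots.toFinset : Set ℂ) := by
    ext ζ
    rw [Finset.mem_coe, Multiset.mem_toFinset, Polynomial.mem_roots N'.charpoly_monic.ne_zero]
    exact Matrix.mem_spectrum_iff_isRoot_charpoly
  rw [hroots]
  refine Set.eq_of_subset_of_ncard_le ?_ ?_ (Finset.finite_toSet _)
  · rw [← hroots]
    rintro _ ⟨i, rfl⟩
    obtain ⟨z, hz, hN⟩ := h i
    rw [eigenvalueSet, ← Matrix.spectrum_toLin', ← Module.End.hasEigenvalue_iff_mem_spectrum]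
    exact Module.End.hasEigenvalue_of_hasEigenvector
      (Module.End.hasEigenvector_iff.2 ⟨Module.End.mem_eigenspace_iff.2 hN, hz⟩)
  · rw [Set.ncard_coe_finset, ← Set.image_univ, Set.ncard_image_of_injective _ hf,
      Set.ncard_univ, Nat.card_eq_fintype_card, hcard, ← N'.charpoly_natDegree_eq_dim]
    exact (Multiset.toFinset_card_le _).trans (Polynomial.card_roots' _)

end Spectrum

end SkewInverseEigenvalue

/-! ### The model matrix and its cyclic vector. -/

namespace SkewInverseEigenvalue

open Module Matrix

section ModelMatrix

variable {n : ℕ} (mu β : Fin n → ℝ)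

/-- The skew-symmetric matrix that pairs the index `k` with its reversal, with weight `mu k`. -/
def reversalMatrix : Matrix (Fin n) (Fin n) ℝ :=
  Matrix.of fun k l => if k = l.rev then mu l else 0

/-- The bordering of the matrix `reversalMatrix mu` by the vector `β`. -/
def borderedMatrix : Matrix (Option (Fin n)) (Option (Fin n)) ℝ :=
  Matrix.of fun i j => i.elim (j.elim 0 fun l => -β l)
    fun k => j.elim (β k) fun l => reversalMatrix mu k l

variable {mu β}

theorem borderedMatrix_transpose (hmu : ∀ k : Fin n, mu k = -mu k.rev) :
    (borderedMatrix mu β)ᵀ = -borderedMatrix mu β := by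
  ext i j
  cases i with
  | none => cases j <;> simp [borderedMatrix]
  | some k =>
    cases j with
    | none => simp [borderedMatrix]
    | some l =>
      simp only [borderedMatrix, reversalMatrix, transpose_apply, of_apply, Matrix.neg_apply,
        Option.elim_some]
      by_cases h : k = l.rev
      · rw [if_pos h, if_pos (by rw [h, Fin.rev_rev]), h, hmu l, neg_neg]
      · rw [if_neg h, if_neg (fun h' => h (by rw [h', Fin.rev_rev])), neg_zero]

theorem reversalMatrix_mulVec (hmu : ∀ k : Fin n, mu k = -mu k.rev) (y : Fin n → ℂ) (k : Fin n) :
    ((reversalMatrix mu).map (fun a : ℝ => (a : ℂ)) *ᵥ y) k = -(mu k : ℂ) * y k.rev := by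
  rw [mulVec, dotProduct, Finset.sum_eq_single k.rev]
  · simp only [reversalMatrix, map_apply, of_apply, Fin.rev_rev, if_true]
    rw [hmu k, Complex.ofReal_neg, neg_neg]
  · intro l _ hl
    have : k ≠ l.rev := fun h => hl (by rw [h, Fin.rev_rev])
    simp [reversalMatrix, this]
  · exact fun h => absurd (Finset.mem_univ _) h

theorem hasComplexEigenvalue_reversalMatrix (hmu : ∀ k : Fin n, mu k = -mu k.rev) (k : Fin n) :
    HasComplexEigenvalue (reversalMatrix mu) (Complex.I * mu k) := by
  refine ⟨fun l => (if l = k then 1 else 0) - Complex.I * (if l = k.rev then 1 else 0), ?_, ?_⟩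
  · intro h
    have h1 := congrFun h k
    simp only [if_true, Pi.zero_apply] at h1
    -- At the middle index, where `k = k.rev`, the vector has the entry `1 - I`, still nonzero.
    split_ifs at h1
    · have := congrArg Complex.re h1
      simp at this
    · simp at h1
  · funext l
    rw [reversalMatrix_mulVec hmu]
    simp only [Pi.smul_apply, smul_eq_mul]
    have h1 : (l.rev = k) = (l = k.rev) := by rw [Fin.rev_eq_iff]
    have h2 : (l.rev = k.rev) = (l = k) := by rw [Fin.rev_inj]
    simp only [h1, h2]
    have hI := Complex.I_mul_I
    by_cases hk : l = k
    · subst hk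
      by_cases hk' : l = l.rev
      · have h3 : mu l = 0 := by
          have := hmu l
          rw [← hk'] at this
          linarith
        simp [h3]
      · simp only [if_true, hk', if_false]
        ring
    · by_cases hk' : l = k.rev
      · have h3 : (mu l : ℂ) = -mu k := by
          rw [hmu k, hk', Complex.ofReal_neg, neg_neg]
        simp only [if_neg hk, if_pos hk']
        rw [h3]
        linear_combination (mu k : ℂ) * hI
      · simp [hk, hk']

theorem borderedMatrix_mulVec_none (z : Option (Fin n) → ℂ) :
    ((borderedMatrix mu β).map (fun a : ℝ => (a : ℂ)) *ᵥ z) none =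
      -∑ k, (β k : ℂ) * z (some k) := by
  rw [mulVec, dotProduct, Fintype.sum_option, ← Finset.sum_neg_distrib]
  simp [borderedMatrix]

theorem borderedMatrix_mulVec_some (hmu : ∀ k : Fin n, mu k = -mu k.rev)
    (z : Option (Fin n) → ℂ) (k : Fin n) :
    ((borderedMatrix mu β).map (fun a : ℝ => (a : ℂ)) *ᵥ z) (some k) =
      (β k : ℂ) * z none - mu k * z (some k.rev) := by
  have h := reversalMatrix_mulVec hmu (fun l => z (some l)) k
  rw [mulVec, dotProduct] at h
  rw [mulVec, dotProduct, Fintype.sum_option]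
  simp only [borderedMatrix, map_apply, of_apply, Option.elim_some, Option.elim_none] at h ⊢
  rw [h]
  ring

theorem borderedMatrix_eigenvector (hmu : ∀ k : Fin n, mu k = -mu k.rev)
    (hβ : ∀ k : Fin n, β k.rev = β k) {x : ℝ} (hx : ∀ k, x ≠ mu k)
    (h : x = ∑ k, β k ^ 2 / (x - mu k)) :
    ∃ z : Option (Fin n) → ℂ, z none = 1 ∧
      (borderedMatrix mu β).map (fun a : ℝ => (a : ℂ)) *ᵥ z = (Complex.I * x) • z := by
  have hx1 : ∀ k, (x : ℂ) - mu k ≠ 0 := fun k => by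
    rw [← Complex.ofReal_sub, Complex.ofReal_ne_zero, sub_ne_zero]
    exact hx k
  have hx2 : ∀ k, (x : ℂ) + mu k ≠ 0 := fun k => by
    rw [hmu k, Complex.ofReal_neg, ← sub_eq_add_neg]
    exact hx1 k.rev
  have hI := Complex.I_mul_I
  have hs1 : (x : ℂ) = ∑ k, (β k : ℂ) ^ 2 / (x - mu k) := by
    conv_lhs => rw [h]
    push_cast
    rfl
  have hs2 : (x : ℂ) = ∑ k, (β k : ℂ) ^ 2 / (x + mu k) := by
    conv_lhs => rw [hs1]
    rw [← Equiv.sum_comp Fin.revPerm]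
    refine Finset.sum_congr rfl fun k _ => ?_
    rw [Fin.revPerm_apply, hβ, hmu k, Complex.ofReal_neg, ← sub_eq_add_neg]
  -- Rows `k` and `k.rev` form a 2×2 system for the coordinates there, with determinant `mu k ^ 2 -
  -- x ^ 2`; this is its solution. Row `none` then reduces, by partial fractions, to the equation
  -- for `x` and its reversal.
  refine ⟨fun i => i.elim 1 fun k =>
    -(β k * (Complex.I * x - mu k) / ((x - mu k) * (x + mu k))), rfl, ?_⟩
  funext i
  rw [Pi.smul_apply, smul_eq_mul]
  cases i with
  | none =>
    rw [borderedMatrix_mulVec_none]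
    simp only [Option.elim_some, Option.elim_none]
    calc -∑ k, (β k : ℂ) * -(β k * (Complex.I * x - mu k) / ((x - mu k) * (x + mu k)))
        = ∑ k, ((Complex.I - 1) / 2 * ((β k : ℂ) ^ 2 / (x - mu k)) +
            (Complex.I + 1) / 2 * ((β k : ℂ) ^ 2 / (x + mu k))) := by
          rw [← Finset.sum_neg_distrib]
          refine Finset.sum_congr rfl fun k _ => ?_
          have := hx1 k
          have := hx2 k
          field_simp
          ring
      _ = (Complex.I - 1) / 2 * x + (Complex.I + 1) / 2 * x := by
          rw [Finset.sum_add_distrib, ← Finset.mul_sum, ← Finset.mul_sum, ← hs1, ← hs2]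
      _ = Complex.I * x * 1 := by ring
  | some k =>
    rw [borderedMatrix_mulVec_some hmu]
    have h3 : (mu k.rev : ℂ) = -mu k := by rw [hmu k, Complex.ofReal_neg, neg_neg]
    simp only [Option.elim_some, Option.elim_none, hβ, h3]
    have := hx1 k
    have := hx2 k
    have h4 : (x : ℂ) - -mu k ≠ 0 := by simpa using hx2 k
    have h5 : (x : ℂ) + -mu k ≠ 0 := by simpa [← sub_eq_add_neg] using hx1 k
    rw [sub_neg_eq_add, ← sub_eq_add_neg]
    field_simp
    linear_combination (β k * (x : ℂ) ^ 2 * (x + mu k)) * hI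

end ModelMatrix

section Transfer

/-- The operator on Euclidean space given by a real matrix. -/
noncomputable abbrev matrixOperator {ι : Type*} [Fintype ι] [DecidableEq ι] (N : Matrix ι ι ℝ) :
    EuclideanSpace ℝ ι →ₗ[ℝ] EuclideanSpace ℝ ι :=
  Matrix.toLpLin 2 2 N

variable {ι : Type*} [Fintype ι] [DecidableEq ι] {N : Matrix ι ι ℝ}

theorem inner_matrixOperator (x y : EuclideanSpace ℝ ι) :
    inner ℝ x (matrixOperator N y) = ∑ i, ∑ j, x i * N i j * y j := by
  rw [PiLp.inner_apply]
  refine Finset.sum_congr rfl fun i _ => ?_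
  have h : (matrixOperator N y) i = ∑ j, N i j * y j := rfl
  rw [h, RCLike.inner_apply, RCLike.conj_to_real, mul_comm, Finset.mul_sum]
  exact Finset.sum_congr rfl fun j _ => (mul_assoc _ _ _).symm

theorem isSkew_matrixOperator (hN : Nᵀ = -N) : IsSkew (matrixOperator N) := by
  intro x y
  rw [real_inner_comm, inner_matrixOperator, inner_matrixOperator, Finset.sum_comm,
    ← Finset.sum_neg_distrib]
  refine Finset.sum_congr rfl fun i _ => ?_
  rw [← Finset.sum_neg_distrib]
  refine Finset.sum_congr rfl fun j _ => ?_
  have : N j i = -N i j := congrFun (congrFun hN i) j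
  rw [this]
  ring

/-- A real matrix of size `m` with `m` distinct complex eigenvalues, none of whose eigenvectors
vanishes at the index `i₀`, is generated by the basis vector of index `i₀`. -/
theorem generates_matrixOperator {m : ℕ} (hm : m = Fintype.card ι) {f : Fin m → ℂ}
    (hf : Function.Injective f) {i₀ : ι}
    (h : ∀ j, ∃ z : ι → ℂ, z i₀ = 1 ∧ N.map (fun a : ℝ => (a : ℂ)) *ᵥ z = f j • z) :
    Generates (matrixOperator N) (EuclideanSpace.single i₀ 1) := by
  intro W hW hW0
  choose z hz1 hz using h
  have hne : ∀ j, z j ≠ 0 := fun j h0 => one_ne_zero (hz1 j ▸ congrFun h0 i₀)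
  have hli : LinearIndependent ℂ z := Module.End.eigenvectors_linearIndependent'
    (Matrix.toLin' (N.map (fun a : ℝ => (a : ℂ)))) f hf z fun j =>
      Module.End.hasEigenvector_iff.2 ⟨Module.End.mem_eigenspace_iff.2 (hz j), hne j⟩
  rw [Submodule.eq_bot_iff]
  intro x hx
  let zb := basisOfLinearIndependentOfCardEqFinrank' z hli
    (by rw [Fintype.card_fin, Module.finrank_fintype_fun_eq_card, hm])
  let xc : ι → ℂ := fun i => (x i : ℂ)
  have hzb : ∀ j, zb j = z j := fun j => by simp [zb]
  have hx1 : xc = ∑ j, zb.repr xc j • z j := by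
    conv_lhs => rw [← zb.sum_repr xc]
    exact Finset.sum_congr rfl fun j _ => by rw [hzb]
  let A := Matrix.toLin' (N.map (fun a : ℝ => (a : ℂ)))
  have hpow : ∀ k : ℕ, (A ^ k) xc = fun i => (((matrixOperator N ^ k) x) i : ℂ) := by
    intro k
    induction k with
    | zero => rfl
    | succ k ih =>
      rw [pow_succ', Module.End.mul_apply, ih, pow_succ', Module.End.mul_apply]
      funext i
      simp [A, Matrix.toLin'_apply, mulVec, dotProduct]
  have hWpow : ∀ k : ℕ, (matrixOperator N ^ k) x ∈ W := by
    intro k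
    induction k with
    | zero => exact hx
    | succ k ih =>
      rw [pow_succ', Module.End.mul_apply]
      exact hW _ ih
  have hzpow : ∀ (k : ℕ) j, (A ^ k) (z j) = f j ^ k • z j := by
    intro k j
    induction k with
    | zero => simp
    | succ k ih =>
      rw [pow_succ', Module.End.mul_apply, ih, map_smul, pow_succ, mul_smul]
      congr 1
      exact hz j
  -- The orbit of `x` stays in `W`, so its coordinates at `i₀` vanish. Each eigenvector has
  -- coordinate `1` there, which leaves a Vandermonde system for the coefficients of `x`.
  have hc : (fun j => zb.repr xc j) = 0 := by
    refine Matrix.eq_zero_of_forall_pow_sum_mul_pow_eq_zero hf fun k => ?_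
    have h1 : (A ^ (k : ℕ)) xc i₀ = 0 := by
      rw [hpow, Complex.ofReal_eq_zero]
      have := hW0 _ (hWpow k)
      simpa [EuclideanSpace.inner_single_left] using this
    rw [hx1, map_sum, Finset.sum_apply] at h1
    rw [← h1]
    refine Finset.sum_congr rfl fun j _ => ?_
    rw [map_smul, hzpow, Pi.smul_apply, Pi.smul_apply, hz1, smul_eq_mul, smul_eq_mul, mul_one]
  ext i
  have h2 := congrFun hx1 i
  have h3 : ∀ j, zb.repr xc j = 0 := fun j => congrFun hc j
  simp only [h3, zero_smul, Finset.sum_const_zero, Pi.zero_apply] at h2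
  exact Complex.ofReal_eq_zero.1 h2

end Transfer

end SkewInverseEigenvalue

/-! ### Back to matrices. -/

namespace SkewInverseEigenvalue

open Module Matrix

/-- The matrix whose columns are the coordinate vectors of an orthonormal basis. -/
noncomputable def basisMatrix {ι κ : Type*} [Fintype ι] [Fintype κ]
    (b : OrthonormalBasis κ ℝ (EuclideanSpace ℝ ι)) : Matrix ι κ ℝ :=
  Matrix.of fun i j => b j i

theorem basisMatrix_mul_transpose {ι κ : Type*} [Fintype ι] [DecidableEq ι] [Fintype κ]
    (b : OrthonormalBasis κ ℝ (EuclideanSpace ℝ ι)) :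
    basisMatrix b * (basisMatrix b)ᵀ = 1 := by
  ext i k
  have h := b.sum_inner_mul_inner (EuclideanSpace.single i 1) (EuclideanSpace.single k 1)
  simp only [EuclideanSpace.inner_single_left, EuclideanSpace.inner_single_right, map_one,
    one_mul, RCLike.conj_to_real] at h
  rw [Matrix.mul_apply, Matrix.one_apply]
  simpa [basisMatrix, Pi.single_apply, eq_comm] using h

section Border

variable {n : ℕ} {mu β : Fin n → ℝ} {κ : Type*} [Fintype κ] {v : κ}
  {b : OrthonormalBasis κ ℝ (EuclideanSpace ℝ (Option (Fin n)))}

theorem matrix_inner_eq {ι : Type*} [Fintype ι] [DecidableEq ι] (N : Matrix ι ι ℝ)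
    (b : OrthonormalBasis κ ℝ (EuclideanSpace ℝ ι)) :
    (Matrix.of fun i j => inner ℝ (b i) (matrixOperator N (b j))) =
      (basisMatrix b)ᵀ * N * basisMatrix b := by
  ext i j
  simp only [of_apply, inner_matrixOperator, Matrix.mul_apply, transpose_apply, basisMatrix,
    Finset.sum_mul]
  exact Finset.sum_comm

/-- The matrix `basisMatrix b` with the row `none` and the column `v` deleted. -/
noncomputable def deletedBasisMatrix (b : OrthonormalBasis κ ℝ (EuclideanSpace ℝ (Option (Fin n)))) (v : κ) :
    Matrix (Fin n) {x : κ // x ≠ v} ℝ :=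
  Matrix.of fun k j => b j (some k)

/-- Column `v` of `basisMatrix b` is the unit vector at `none`, so it contributes nothing to the
products of the remaining rows. -/
theorem deletedBasisMatrix_mul_transpose [DecidableEq κ]
    (hb : b v = EuclideanSpace.single none 1) :
    deletedBasisMatrix b v * (deletedBasisMatrix b v)ᵀ = 1 := by
  ext k l
  have h := congrFun (congrFun (basisMatrix_mul_transpose b) (some k)) (some l)
  rw [Matrix.mul_apply, ← Finset.add_sum_erase _ _ (Finset.mem_univ v)] at h
  have hv : b v (some k) = 0 := by rw [hb]; simp
  simp only [transpose_apply, basisMatrix, of_apply, hv, zero_mul, zero_add] at h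
  rw [Matrix.mul_apply, Matrix.one_apply]
  rw [Matrix.one_apply] at h
  simp only [Option.some_inj] at h
  rw [← h]
  simp only [transpose_apply, deletedBasisMatrix, of_apply]
  symm
  refine Finset.sum_subtype _ (fun x => ?_) fun x => b x (some k) * b x (some l)
  simp

theorem deleteRowCol_matrix_inner (hb : b v = EuclideanSpace.single none 1) :
    deleteRowCol (Matrix.of fun i j => inner ℝ (b i) (matrixOperator (borderedMatrix mu β) (b j)))
        v =
      (deletedBasisMatrix b v)ᵀ * reversalMatrix mu * deletedBasisMatrix b v := by
  have h0 : ∀ j : {x : κ // x ≠ v}, b j none = 0 := by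
    intro j
    have h := b.inner_eq_zero j.2.symm
    rw [hb, EuclideanSpace.inner_single_left] at h
    simpa using h
  ext i j
  simp only [deleteRowCol, submatrix_apply, of_apply, inner_matrixOperator, Fintype.sum_option,
    h0, zero_mul, mul_zero, zero_add, Finset.sum_const_zero, Matrix.mul_apply, transpose_apply,
    deletedBasisMatrix, Finset.sum_mul]
  exact Finset.sum_comm

end Border

/-- Every supergraph of a nearly even branching tree is the graph of a skew-symmetric matrix with
prescribed symmetric interlacing spectra for the matrix and for its principal submatrix at the
root of the tree. -/
theorem IsNEB.exists_skewMatrix {n : ℕ} (hn : 1 ≤ n) {G T : SimpleGraph (Fin (n + 1))}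
    {v : Fin (n + 1)} (hNEB : IsNEB T v) (hTree : T.IsTree) (hTG : T ≤ G)
    {lam : Fin (n + 1) → ℝ} {mu : Fin n → ℝ}
    (hinterlace : ∀ k : Fin n, lam k.castSucc < mu k ∧ mu k < lam k.succ)
    (hlam : ∀ j : Fin (n + 1), lam j = -lam j.rev)
    (hmu : ∀ k : Fin n, mu k = -mu k.rev) :
    ∃ A ∈ skewMatrices G,
      eigenvalueSet A = Set.range (fun j : Fin (n + 1) => Complex.I * (lam j : ℂ)) ∧
      eigenvalueSet (deleteRowCol A v) =
        Set.range (fun k : Fin n => Complex.I * (mu k : ℂ)) := by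
  obtain ⟨w, hw, hwrev, hsum⟩ := exists_interlacing_weights hinterlace hn hlam hmu
  -- Bordering by square roots makes the squares in `borderedMatrix_eigenvector` equal to the
  -- weights.
  let β : Fin n → ℝ := fun k => √(w k)
  let N := borderedMatrix mu β
  have hN : N.transpose = -N := borderedMatrix_transpose hmu
  have hinj : ∀ {m : ℕ} {f : Fin m → ℝ}, StrictMono f →
      Function.Injective fun j => Complex.I * (f j : ℂ) := fun hf i j hij =>
    hf.injective (Complex.ofReal_injective (mul_left_cancel₀ Complex.I_ne_zero hij))
  have hinjlam := hinj (strictMono_of_interlace hinterlace)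
  have hinjmu := hinj (strictMono_mu_of_interlace hinterlace)
  have heig : ∀ j, ∃ z : Option (Fin n) → ℂ, z none = 1 ∧
      N.map (fun a : ℝ => (a : ℂ)) *ᵥ z = (Complex.I * lam j) • z := fun j =>
    borderedMatrix_eigenvector hmu (fun k => by simp only [β, hwrev])
      (ne_of_interlace hinterlace j) (by
        simp only [β, Real.sq_sqrt (hw _).le]
        exact hsum j)
  have hgen := generates_matrixOperator (by simp) hinjlam heig
  have hskew := isSkew_matrixOperator hN
  obtain ⟨b₀, hb₀⟩ := hNEB.realizable hTree inferInstance _ _ _ hskew hgen (by simp) (by simp)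
  obtain ⟨b, hbv, hb⟩ := hb₀.exists_of_le hTree hTG hskew
  refine ⟨Matrix.of fun i j => inner ℝ (b i) (matrixOperator N (b j)), ⟨?_, hb⟩, ?_, ?_⟩
  · ext i j
    change inner ℝ (b j) (matrixOperator N (b i)) = -inner ℝ (b i) (matrixOperator N (b j))
    rw [real_inner_comm, hskew]
  · refine eigenvalueSet_eq_range hinjlam rfl fun j => ?_
    rw [matrix_inner_eq]
    obtain ⟨z, hz, hNz⟩ := heig j
    exact HasComplexEigenvalue.conj ⟨z, fun h => one_ne_zero (hz ▸ congrFun h none), hNz⟩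
      (basisMatrix_mul_transpose b)
  · refine eigenvalueSet_eq_range hinjmu (by simp) fun k => ?_
    rw [deleteRowCol_matrix_inner hbv]
    exact (hasComplexEigenvalue_reversalMatrix hmu k).conj (deletedBasisMatrix_mul_transpose hbv)

end SkewInverseEigenvalue

/-- The number of vertices is `n + 1 ≥ 2`, and all indices start at `0`: `lam j` and `mu k` are the
numbers usually written with subscripts `j + 1` and `k + 1`, so the symmetry condition is
reversal of the index. -/
theorem theorem5p2 (n : ℕ) (hn : 1 ≤ n)
    (G T : SimpleGraph (Fin (n + 1))) (v : Fin (n + 1))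
    (hG : G.Connected) (hTree : T.IsTree) (hTG : T ≤ G)
    (hNEB : SkewInverseEigenvalue.IsNEB T v)
    (lam : Fin (n + 1) → ℝ) (mu : Fin n → ℝ)
    (hinterlace : ∀ k : Fin n, lam k.castSucc < mu k ∧ mu k < lam k.succ)
    (hlam : ∀ j : Fin (n + 1), lam j = -lam j.rev)
    (hmu : ∀ k : Fin n, mu k = -mu k.rev) :
    ∃ A ∈ SkewInverseEigenvalue.skewMatrices G,
      SkewInverseEigenvalue.eigenvalueSet A =
          Set.range (fun j : Fin (n + 1) => Complex.I * (lam j : ℂ)) ∧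
      SkewInverseEigenvalue.eigenvalueSet (SkewInverseEigenvalue.deleteRowCol A v) =
          Set.range (fun k : Fin n => Complex.I * (mu k : ℂ)) :=
  hNEB.exists_skewMatrix hn hTree hTG hinterlace hlam hmu
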